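/- A \emph{Buffon machine} is here a register program (finite control, integer counters, string registers holding finite bit strings) that may flip an unbiased coin and may call, as an external routine, a perfect Bernoulli generator $\Gamma\mathrm{B}(\lambda)$ whose parameter $\lambda$ is not known to it. All coin flips and generator outcomes are independent. It \emph{strongly simulates} a family of discrete distributions $D_\lambda$, $\lambda\in(0,1)$, if for every $\lambda\in(0,1)$ it halts with probability $1$, its output has exactly the distribution $D_\lambda$, and its cost $C$ (the number of coin flips plus the number of calls to $\Gamma\mathrm{B}(\lambda)$) has exponential tails: there are constants $K$ and $0\le\rho<1$, possibly depending on $\lambda$, with $\mathbb P(C>m)\le K\rho^m$ for all integers $m\ge 0$. For a class $\mathcal P$ of permutations, with $P_n$ members of size $n$, the \emph{von Neumann schema} $\Gamma\mathrm{VN}[\mathcal P](\lambda)$ repeats the following trial until it succeeds: draw $N$ with $\mathbb P(N=n)=(1-\lambda)\lambda^n$, by calling $\Gamma\mathrm{B}(\lambda)$ until the first failure and counting the successes; draw independent uniform $U_1,\dots,U_N\in[0,1]$; succeed, and return $N$, if the order type of $(U_1,\dots,U_N)$ (each $U_j$ replaced by its rank) belongs to $\mathcal P$. Let $\mathcal R$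 be the class of sorted permutations and $\mathcal S$ the class of non-empty permutations whose first element is the largest. \textbf{Theorem.} The following two explicit Buffon machines, each of which uses a single string register (besides three integer counters), implement $\Gamma\mathrm{VN}[\mathcal R]$ and $\Gamma\mathrm{VN}[\mathcal S]$ respectively. In each trial $N$ is drawn as above; the bits of the $U_j$ are then produced by coin flips, only when needed, and a trial is abandoned as soon as it is known to fail. For $\mathcal R$, each new entry is generated bit by bit and compared with the preceding one, whose known leading bits are kept in the string register; the trial fails if the new entry is smaller, and otherwise its known bits replace the contents of the register. For $\mathcal S$, each new entry is compared in the same way with $U_1$, whose known leading bits are kept in the string register, and the trial fails if the new entry is larger, or if $N=0$. "Implement" means that for every $\lambda\in(0,1)$ the sequence of outcomes of $\Gamma\mathrm{B}(\lambda)$, the output, and the number of calls to $\Gamma\mathrm{B}(\lambda)$ have jointly the same distribution for the machine as for the schema. Moreover: (i) the machine for $\mathcal R$ strongly simulates the Poisson distribution $\mathbb P(X=n)=e^{-\lambda}\lambda^n/n!$, $n\ge0$, and $\sum_{n\ge0}R_n z^n/n!=e^z$ for all real $z$; (ii) the machine for $\mathcal S$ strongly simulates the logarithmic-series distribution $\mathbb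 P(X=n)=\frac1L\,\frac{\lambda^n}{n}$, $n\ge1$, where $L=\log(1-\lambda)^{-1}$, and $\sum_{n\ge0}S_n z^n/n!=\log(1-z)^{-1}$ for all real $z$ with $|z|<1$. -/

import Mathlib

open MeasureTheory ProbabilityTheory

namespace Buffon

/-! ## Register machines with a coin and a Bernoulli generator as external routines

A program is a finite list of instructions. The registers are integer counters and string
registers (finite sequences of bits), both named by natural numbers. Labels are positions in the
list. An instruction that does not jump passes control to the next one. -/

/-- The instruction set. -/
inductive Instr : Type
  /-- unconditional jump to label `l` -/
  | goto (l : ℕ)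
  /-- counter `c := 0` -/
  | zero (c : ℕ)
  /-- counter `c := c + 1` -/
  | inc (c : ℕ)
  /-- if counter `c` is `0`, jump to `l`; otherwise `c := c - 1` -/
  | decOrJump (c l : ℕ)
  /-- flip the unbiased coin and jump to `l` if the outcome is `1` -/
  | flip (l : ℕ)
  /-- call the Bernoulli generator given as input and jump to `l` if the outcome is `1` -/
  | call (l : ℕ)
  /-- string register `s :=` empty string -/
  | clear (s : ℕ)
  /-- append the bit `b` at the end of string register `s` -/
  | push (s : ℕ) (b : Bool)
  /-- keep only the first `c` bits of string register `s`, where `c` is a counter -/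
  | trunc (s c : ℕ)
  /-- inspect the bit of string register `s` whose position (counted from `0`) is in counter `c`:
  jump to `l0` if it is `0`, to `l1` if it is `1`, and do not jump if there is no such bit -/
  | read (s c l0 l1 : ℕ)
  /-- write the value of counter `c` on the output and halt -/
  | ret (c : ℕ)

abbrev Program : Type := List Instr

/-- The string registers that an instruction refers to. -/
def Instr.strings : Instr → Finset ℕ
  | .clear s => {s}
  | .push s _ => {s}
  | .trunc s _ => {s}
  | .read s _ _ _ => {s}
  | _ => ∅

/-- The string registers that a program uses. -/
def stringRegisters (p : Program) : Finset ℕ :=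
  p.foldr (fun i t => i.strings ∪ t) ∅

/-- What the outside world supplies: the successive outcomes of the unbiased coin (`coin`) and the
successive outcomes of the Bernoulli generator (`input`). -/
abbrev Source : Type := (ℕ → Bool) × (ℕ → Bool)

abbrev Source.coin (ω : Source) : ℕ → Bool := ω.1

abbrev Source.input (ω : Source) : ℕ → Bool := ω.2

/-- Configurations: current label, contents of the registers, and the numbers of coin flips and of
calls to the Bernoulli generator made so far. -/
structure Config : Type where
  pc : ℕ
  counter : ℕ → ℕ
  string : ℕ → List Bool
  flips : ℕ
  calls : ℕ

/-- At the start all registers are empty. -/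
def Config.init : Config := ⟨0, fun _ => 0, fun _ => [], 0, 0⟩

/-- The effect of one instruction. -/
def Instr.exec (ω : Source) (k : Config) : Instr → Config
  | .goto l => { k with pc := l }
  | .zero c => { k with pc := k.pc + 1, counter := Function.update k.counter c 0 }
  | .inc c => { k with pc := k.pc + 1, counter := Function.update k.counter c (k.counter c + 1) }
  | .decOrJump c l =>
      if k.counter c = 0 then { k with pc := l }
      else { k with pc := k.pc + 1, counter := Function.update k.counter c (k.counter c - 1) }
  | .flip l =>
      { k with pc := if ω.coin k.flips then l else k.pc + 1, flips := k.flips + 1 }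
  | .call l =>
      { k with pc := if ω.input k.calls then l else k.pc + 1, calls := k.calls + 1 }
  | .clear s => { k with pc := k.pc + 1, string := Function.update k.string s [] }
  | .push s b =>
      { k with pc := k.pc + 1, string := Function.update k.string s (k.string s ++ [b]) }
  | .trunc s c =>
      { k with
        pc := k.pc + 1
        string := Function.update k.string s ((k.string s).take (k.counter c)) }
  | .read s c l0 l1 =>
      match (k.string s)[k.counter c]? with
      | none => { k with pc := k.pc + 1 }
      | some false => { k with pc := l0 }
      | some true => { k with pc := l1 }
  | .ret _ => k

/-- One step of a program; outside the program nothing happens any more. -/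
def step (p : Program) (ω : Source) (k : Config) : Config :=
  match p[k.pc]? with
  | none => k
  | some i => i.exec ω k

/-- The configuration after `t` steps. -/
def run (p : Program) (ω : Source) (t : ℕ) : Config :=
  (step p ω)^[t] Config.init

/-- The program halts with output `n`, after `f` coin flips and `c` calls to the Bernoulli
generator. -/
def HaltsWith (p : Program) (ω : Source) (n f c : ℕ) : Prop :=
  ∃ t r, p[(run p ω t).pc]? = some (Instr.ret r) ∧
    (run p ω t).counter r = n ∧ (run p ω t).flips = f ∧ (run p ω t).calls = c

/-! ## Randomness and strong simulation -/

/-- The law of an infinite sequence of independent Bernoulli variables of parameter `q`. -/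
noncomputable def bernoulliSequence (q : unitInterval) : Measure (ℕ → Bool) :=
  Measure.infinitePi fun _ : ℕ => bernoulliMeasure true false q

/-- The parameter `1/2` of the unbiased coin. -/
noncomputable def half : unitInterval := ⟨1 / 2, by norm_num, by norm_num⟩

/-- Unbiased coin flips and, independently of them, a perfect Bernoulli generator of parameter
`lam`. -/
noncomputable def source (lam : unitInterval) : Measure Source :=
  (bernoulliSequence half).prod (bernoulliSequence lam)

/-- `p` strongly simulates the distributions `law lam`, for `0 < lam < 1`: supplied with a
Bernoulli generator of the (unknown) parameter `lam`, the program halts with probability `1`, its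
output has exactly the distribution `law lam`, and its cost has exponential tails. The cost counts
the coin flips and also the calls to the Bernoulli generator; runs that do not halt have infinite
cost. -/
def StronglySimulates (p : Program) (law : ℝ → ℕ → ℝ) : Prop :=
  ∀ lam : unitInterval, 0 < lam → lam < 1 →
    (∀ᵐ ω ∂source lam, ∃ n f c, HaltsWith p ω n f c) ∧
    (∀ n, source lam {ω | ∃ f c, HaltsWith p ω n f c} = ENNReal.ofReal (law lam n)) ∧
    ∃ K ρ : ℝ, 0 ≤ ρ ∧ ρ < 1 ∧ ∀ m : ℕ,
      source lam {ω | ¬ ∃ n f c, HaltsWith p ω n f c ∧ f + c ≤ m} ≤ ENNReal.ofReal (K * ρ ^ m)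

/-- The Poisson distribution of parameter `lam`. -/
noncomputable def poissonLaw (lam : ℝ) (n : ℕ) : ℝ :=
  Real.exp (-lam) * lam ^ n / n.factorial

/-- The logarithmic-series distribution of parameter `lam`. -/
noncomputable def logarithmicLaw (lam : ℝ) (n : ℕ) : ℝ :=
  if n = 0 then 0 else 1 / Real.log (1 - lam)⁻¹ * (lam ^ n / n)

/-! ## Classes of permutations and the von Neumann schema -/

/-- A class of permutations: for every size `n`, a set of permutations of `n` elements. -/
abbrev PermClass : Type := ∀ n : ℕ, Set (Equiv.Perm (Fin n))

/-- The class `R` of sorted permutations. -/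
def sortedClass : PermClass := fun _ => {σ | Monotone σ}

/-- The class `S` of (nonempty) permutations whose first element is the largest. -/
def firstLargestClass : PermClass := fun n => {σ | ∃ h : 0 < n, ∀ i, σ i ≤ σ ⟨0, h⟩}

/-- The coefficient `P_n / n!` of the exponential generating function of a class. -/
noncomputable def egfCoeff (P : PermClass) (n : ℕ) : ℝ :=
  (P n).ncard / n.factorial

/-- The order type of a vector: every entry is replaced by its rank. -/
def orderType {n : ℕ} {α : Type*} [LinearOrder α] (u : Fin n → α) : Equiv.Perm (Fin n) :=
  (Tuple.sort u)⁻¹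

/-- Geometric variable read off from Bernoulli variables: the number of successes from place `s`
on, before the first failure. -/
noncomputable def geometric (x : ℕ → Bool) (s : ℕ) : ℕ :=
  sInf {n | x (s + n) = false}

/-- The number of Bernoulli variables consumed by the geometric variables of the first `k` trials
(each of them takes its successes and the failure that ends them). -/
noncomputable def consumed (x : ℕ → Bool) : ℕ → ℕ
  | 0 => 0
  | k + 1 => consumed x k + geometric x (consumed x k) + 1

/-- The size `N` drawn in trial number `k`. -/
noncomputable def trialSize (x : ℕ → Bool) (k : ℕ) : ℕ :=
  geometric x (consumed x k)

/-- Trial number `k` draws `N` and then the vector `(U_1, …, U_N)`; it succeeds if the order type of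
the vector is in `P`. -/
def TrialSucceeds (P : PermClass) (x : ℕ → Bool) (U : ℕ × ℕ → unitInterval) (k : ℕ) : Prop :=
  orderType (fun j : Fin (trialSize x k) => U (k, j)) ∈ P (trialSize x k)

/-- The von Neumann schema relative to `P` stops at the first trial that succeeds and returns its
`N`; here the result is `n`, and `c` calls to the Bernoulli generator have been made. -/
def SchemaReturns (P : PermClass) (x : ℕ → Bool) (U : ℕ × ℕ → unitInterval) (n c : ℕ) : Prop :=
  ∃ k, (∀ i < k, ¬ TrialSucceeds P x U i) ∧ TrialSucceeds P x U k ∧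
    trialSize x k = n ∧ consumed x (k + 1) = c

/-- The randomness of the schema: a Bernoulli generator of parameter `lam` and, independently of
it, independent uniform variables on `[0,1]`, with a fresh sequence for every trial. -/
noncomputable def schemaSource (lam : unitInterval) :
    Measure ((ℕ → Bool) × (ℕ × ℕ → unitInterval)) :=
  (bernoulliSequence lam).prod (Measure.infinitePi fun _ : ℕ × ℕ => (volume : Measure unitInterval))

/-- `p` implements the von Neumann schema relative to `P`: jointly, the outcomes of the Bernoulli
generator, the output and the number of calls to the generator (hence also the number of trials)
are distributed in the program as in the schema. -/
def ImplementsSchema (p : Program) (P : PermClass) : Prop :=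
  ∀ lam : unitInterval, 0 < lam → lam < 1 →
    ∀ A : Set (ℕ → Bool), MeasurableSet A → ∀ n c : ℕ,
      source lam {ω | ω.input ∈ A ∧ ∃ f, HaltsWith p ω n f c} =
        schemaSource lam {η | η.1 ∈ A ∧ SchemaReturns P η.1 η.2 n c}

/-! ## The two machines

Counter `0` is `N`, counter `1` is the number of entries of the vector `U` that are still to be
drawn, counter `2` is a position in a binary expansion. The bits of the `U_j` are produced on a
call-by-need basis, and a trial is abandoned as soon as it is known to fail. -/

/-- The von Neumann machine of the sorted permutations. The string register `0` holds the known
leading bits of the last entry `U_j` drawn. The next entry is generated bit by bit as long as it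
agrees with `U_j`; a bit of `U_j` that is needed and not yet known is generated then. -/
def sortedMachine : Program :=
  [ .zero 0,            -- 0: a new trial
    .zero 1,
    .clear 0,
    .call 5,            -- 3: N is geometric
    .goto 8,
    .inc 0,             -- 5
    .inc 1,
    .goto 3,
    .decOrJump 1 27,    -- 8: accept if N = 0; else the first entry, no bit known yet
    .decOrJump 1 27,    -- 9: accept if no entry is left; else draw the next entry
    .zero 2,
    .read 0 2 17 23,    -- 11: the bit of U_j at the current position
    .flip 15,           -- not yet known: generate it
    .push 0 false,
    .goto 11,
    .push 0 true,       -- 15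
    .goto 11,
    .flip 20,           -- 17: it is 0; the bit of the next entry is 1 (to 20) or 0
    .inc 2,
    .goto 11,
    .trunc 0 2,         -- 20: the next entry is larger; it replaces U_j
    .push 0 true,
    .goto 9,
    .flip 25,           -- 23: it is 1; the bit of the next entry is 1 (to 25) or 0
    .goto 0,            -- the next entry is smaller: the trial fails
    .inc 2,             -- 25
    .goto 11,
    .ret 0 ]            -- 27

/-- The von Neumann machine of the permutations whose first element is the largest. The string
register `0` holds the known leading bits of the first entry `U_1`. Every further entry is
generated bit by bit as long as it agrees with `U_1`; a bit of `U_1` that is needed and not yet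
known is generated then. -/
def firstLargestMachine : Program :=
  [ .zero 0,            -- 0: a new trial
    .zero 1,
    .clear 0,
    .call 5,            -- 3: N is geometric
    .goto 8,
    .inc 0,             -- 5
    .inc 1,
    .goto 3,
    .decOrJump 1 0,     -- 8: the trial fails if N = 0; else the first entry, no bit known yet
    .decOrJump 1 24,    -- 9: accept if no entry is left; else draw the next entry
    .zero 2,
    .read 0 2 17 20,    -- 11: the bit of U_1 at the current position
    .flip 15,           -- not yet known: generate it
    .push 0 false,
    .goto 11,
    .push 0 true,       -- 15
    .goto 11,
    .flip 0,            -- 17: it is 0; if the bit of the new entry is 1, the trial fails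
    .inc 2,
    .goto 11,
    .flip 22,           -- 20: it is 1; the bit of the new entry is 1 (to 22) or 0
    .goto 9,            -- the new entry is smaller
    .inc 2,             -- 22
    .goto 11,
    .ret 0 ]            -- 24

end Buffon
open Buffon

/-!
Both machines carry out a flowchart in which every move consumes one flip or one call; its states
say that the generator is being called, that a new entry is being compared with the stored number,
or that the trial has succeeded. A function of the state that decreases by a constant factor on
average at each move bounds the tails of the cost exponentially, so that a machine halts almost
surely. A bounded function that keeps its average along the moves then determines every halting
probability: it bounds the probability of an event of the result as well as that of the complement,
and the two bounds add up to `1`. Its value while an entry is compared with a partially known number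
is the average, over the dyadic interval of the numbers with the known bits, of a probability that
is elementary for a known number. Applied to a generator with prescribed outcomes, the same argument
yields the law of the output for given outcomes of `ΓB(λ)`, hence the joint law with the schema.
-/

namespace Buffon

/-! ### Resampling one coordinate -/

theorem measurePreserving_update_infinitePi {ι : Type*} [DecidableEq ι] {X : ι → Type*}
    [∀ i, MeasurableSpace (X i)] (μ : ∀ i, Measure (X i)) [∀ i, IsProbabilityMeasure (μ i)]
    (a : ι) :
    MeasurePreserving (fun p : (∀ i, X i) × X a => Function.update p.1 a p.2)
      ((Measure.infinitePi μ).prod (μ a)) (Measure.infinitePi μ) := by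
  have hm : Measurable (fun p : (∀ i, X i) × X a => Function.update p.1 a p.2) := by
    fun_prop
  refine ⟨hm, Measure.eq_infinitePi μ fun s t ht => ?_⟩
  rw [Measure.map_apply hm (MeasurableSet.pi s.countable_toSet fun i _ => ht i)]
  have hpre : (fun p : (∀ i, X i) × X a => Function.update p.1 a p.2) ⁻¹' ((s : Set ι).pi t) =
      (((s.erase a : Finset ι) : Set ι).pi t) ×ˢ (if a ∈ s then t a else Set.univ) := by
    ext ⟨x, y⟩
    simp only [Set.mem_preimage, Set.mem_pi, Set.mem_prod, Finset.mem_coe, Finset.mem_erase]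
    constructor
    · intro h
      refine ⟨fun i hi => by simpa [hi.1] using h i hi.2, ?_⟩
      split_ifs with has
      · simpa using h a has
      · trivial
    · rintro ⟨hx, hy⟩ i hi
      by_cases hia : i = a
      · subst hia
        simpa [hi] using hy
      · simpa [hia] using hx i ⟨hia, hi⟩
  rw [hpre, Measure.prod_prod, Measure.infinitePi_pi μ fun i _ => ht i]
  by_cases has : a ∈ s
  · rw [if_pos has, Finset.prod_erase_mul _ _ has]
  · rw [if_neg has, measure_univ, mul_one, Finset.erase_eq_of_notMem has]

theorem measurableSet_mem_apply {Ω : Type*} [MeasurableSpace Ω] {A : Bool → Set Ω}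
    (hA : ∀ b, MeasurableSet (A b)) {X : Ω → Bool} (hX : Measurable X) :
    MeasurableSet {ω | ω ∈ A (X ω)} := by
  have h : {ω | ω ∈ A (X ω)} = ⋃ b, X ⁻¹' {b} ∩ A b := by
    ext ω
    simp
  rw [h]
  exact .iUnion fun b => (hX (measurableSet_singleton b)).inter (hA b)

theorem measureReal_mem_apply_of_resample {Ω : Type*} [MeasurableSpace Ω] {μ : Measure Ω}
    {ν : Measure Bool} [IsProbabilityMeasure μ] [IsProbabilityMeasure ν] {r : Ω × Bool → Ω}
    (hr : MeasurePreserving r (μ.prod ν) μ) {X : Ω → Bool} (hX : Measurable X)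
    (hXr : ∀ ω b, X (r (ω, b)) = b) {A : Bool → Set Ω} (hA : ∀ b, MeasurableSet (A b))
    (hAr : ∀ b ω c, r (ω, c) ∈ A b ↔ ω ∈ A b) :
    μ.real {ω | ω ∈ A (X ω)} =
      ν.real {true} * μ.real (A true) + ν.real {false} * μ.real (A false) := by
  have hpre : r ⁻¹' {ω | ω ∈ A (X ω)} = A true ×ˢ {true} ∪ A false ×ˢ {false} := by
    ext ⟨ω, b⟩
    cases b <;> simp [hXr, hAr]
  have hdisj : Disjoint (A true ×ˢ {true}) (A false ×ˢ {false}) :=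
    Set.disjoint_prod.2 (.inr (by simp))
  rw [← hr.measureReal_preimage (measurableSet_mem_apply hA hX).nullMeasurableSet, hpre,
    measureReal_union hdisj ((hA false).prod (measurableSet_singleton false)),
    measureReal_prod_prod, measureReal_prod_prod]
  ring

/-! ### Sources whose generator varies from call to call -/

theorem bernoulliMeasure_real_singleton_true (p : unitInterval) :
    (bernoulliMeasure true false p).real {true} = p :=
  bernoulliMeasure_real_apply_of_mem_of_notMem p (by simp) (by simp) (by simp)

theorem bernoulliMeasure_real_singleton_false (p : unitInterval) :
    (bernoulliMeasure true false p).real {false} = 1 - p := by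
  rw [bernoulliMeasure_real_apply_of_notMem_of_mem p (by simp) (by simp) (by simp)]

/-- The law of independent Bernoulli variables of parameters `q 0, q 1, …`. -/
noncomputable abbrev bernoulliProduct (q : ℕ → unitInterval) : Measure (ℕ → Bool) :=
  Measure.infinitePi fun i => bernoulliMeasure true false (q i)

/-- A fair coin and, independently of it, a generator whose `i`-th call has parameter `q i`. Besides
the source of a constant parameter this covers prescribed outcomes, the case where every `q i` is
`0` or `1`. -/
noncomputable def variableSource (q : ℕ → unitInterval) : Measure Source :=
  (bernoulliProduct fun _ => half).prod (bernoulliProduct q)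

instance (q : ℕ → unitInterval) : IsProbabilityMeasure (variableSource q) := by
  unfold variableSource
  infer_instance

theorem source_eq_variableSource (lam : unitInterval) :
    source lam = variableSource fun _ => lam := rfl

instance (lam : unitInterval) : IsProbabilityMeasure (source lam) :=
  inferInstanceAs (IsProbabilityMeasure (variableSource fun _ => lam))

section VariableSource

variable (q : ℕ → unitInterval)

theorem measurePreserving_update_input (c : ℕ) :
    MeasurePreserving (fun p : Source × Bool => (p.1.coin, Function.update p.1.input c p.2))
      ((variableSource q).prod (bernoulliMeasure true false (q c))) (variableSource q) :=
  ((MeasurePreserving.id _).prod (measurePreserving_update_infinitePi _ c)).comp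
    (measurePreserving_prodAssoc _ _ _)

theorem measurePreserving_update_coin (f : ℕ) :
    MeasurePreserving (fun p : Source × Bool => (Function.update p.1.coin f p.2, p.1.input))
      ((variableSource q).prod (bernoulliMeasure true false half)) (variableSource q) :=
  Measure.measurePreserving_swap.comp <|
    ((MeasurePreserving.id _).prod
      (measurePreserving_update_infinitePi (fun _ => bernoulliMeasure true false half) f)).comp <|
    (measurePreserving_prodAssoc _ _ _).comp <|
    Measure.measurePreserving_swap.prod (MeasurePreserving.id _)

theorem measureReal_variableSource_input {A : Bool → Set Source}
    (hA : ∀ b, MeasurableSet (A b)) {c : ℕ}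
    (hAc : ∀ b ω v, (ω.coin, Function.update ω.input c v) ∈ A b ↔ ω ∈ A b) :
    (variableSource q).real {ω | ω ∈ A (ω.input c)} =
      q c * (variableSource q).real (A true) + (1 - q c) * (variableSource q).real (A false) := by
  rw [measureReal_mem_apply_of_resample (measurePreserving_update_input q c)
    (X := fun ω : Source => ω.input c) (by fun_prop) (fun _ _ => Function.update_self ..) hA hAc,
    bernoulliMeasure_real_singleton_true, bernoulliMeasure_real_singleton_false]

theorem measureReal_variableSource_coin {A : Bool → Set Source}
    (hA : ∀ b, MeasurableSet (A b)) {f : ℕ}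
    (hAf : ∀ b ω v, (Function.update ω.coin f v, ω.input) ∈ A b ↔ ω ∈ A b) :
    (variableSource q).real {ω | ω ∈ A (ω.coin f)} =
      ((variableSource q).real (A true) + (variableSource q).real (A false)) / 2 := by
  rw [measureReal_mem_apply_of_resample (measurePreserving_update_coin q f)
    (X := fun ω : Source => ω.coin f) (by fun_prop) (fun _ _ => Function.update_self ..) hA hAf,
    bernoulliMeasure_real_singleton_true, bernoulliMeasure_real_singleton_false]
  simp only [half]
  ring

end VariableSource

/-! ### Flowcharts -/

/-- What a flowchart does in a state: halt with an output, or consult the coin or the generator and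
pass to the state selected by the outcome. -/
inductive Move (S : Type*)
  | halt (n : ℕ)
  | flip (next : Bool → S)
  | call (next : Bool → S)

/-- A randomized transition system all of whose moves are random. The register machines are compared
with flowcharts, whose states spell out what the registers mean. -/
abbrev Flowchart (S : Type*) : Type _ := S → Move S

/-- A state of a flowchart together with the numbers of flips and calls made so far. -/
structure Snapshot (S : Type*) where
  state : S
  flips : ℕ
  calls : ℕ

namespace Flowchart

variable {S : Type*} (δ : Flowchart S)

/-- The effect of one move; a halted flowchart does not change any more. -/
def advance (ω : Source) (k : Snapshot S) : Snapshot S :=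
  match δ k.state with
  | .halt _ => k
  | .flip next => ⟨next (ω.coin k.flips), k.flips + 1, k.calls⟩
  | .call next => ⟨next (ω.input k.calls), k.flips, k.calls + 1⟩

/-- The snapshots in which the flowchart has halted, the pair of its output and its number of calls
being in `E`. -/
def haltedIn (E : Set (ℕ × ℕ)) : Set (Snapshot S) :=
  {k | ∃ n, δ k.state = .halt n ∧ (n, k.calls) ∈ E}

/-- The sources on which the flowchart, started in `k`, halts with output and number of calls in
`E`. -/
def haltingEvent (E : Set (ℕ × ℕ)) (k : Snapshot S) : Set Source :=
  {ω | ∃ t, (δ.advance ω)^[t] k ∈ δ.haltedIn E}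

/-- The expected value of `Φ` after one move from `k`, call number `c` having parameter `q c`. -/
noncomputable def mean (q : ℕ → unitInterval) (Φ : Snapshot S → ℝ) (k : Snapshot S) : ℝ :=
  match δ k.state with
  | .halt _ => Φ k
  | .flip next =>
      (Φ ⟨next true, k.flips + 1, k.calls⟩ + Φ ⟨next false, k.flips + 1, k.calls⟩) / 2
  | .call next =>
      q k.calls * Φ ⟨next true, k.flips, k.calls + 1⟩ +
        (1 - q k.calls) * Φ ⟨next false, k.flips, k.calls + 1⟩

variable {δ}

theorem advance_of_mem_haltedIn {E : Set (ℕ × ℕ)} {k : Snapshot S} (hk : k ∈ δ.haltedIn E)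
    (ω : Source) : δ.advance ω k = k := by
  obtain ⟨n, hn, -⟩ := hk
  simp [advance, hn]

theorem iterate_advance_of_mem_haltedIn {E : Set (ℕ × ℕ)} {k : Snapshot S}
    (hk : k ∈ δ.haltedIn E) (ω : Source) (t : ℕ) : (δ.advance ω)^[t] k = k :=
  Function.iterate_fixed (advance_of_mem_haltedIn hk ω) t

theorem monotone_iterate_advance_mem_haltedIn (E : Set (ℕ × ℕ)) (k : Snapshot S) :
    Monotone fun t => {ω | (δ.advance ω)^[t] k ∈ δ.haltedIn E} := by
  intro s t hst ω hω
  obtain ⟨d, rfl⟩ := Nat.exists_eq_add_of_le' hst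
  rw [Set.mem_ofPred_eq] at hω ⊢
  rwa [Function.iterate_add_apply, iterate_advance_of_mem_haltedIn hω]

theorem flips_add_calls_advance_le (ω : Source) (k : Snapshot S) :
    (δ.advance ω k).flips + (δ.advance ω k).calls ≤ k.flips + k.calls + 1 := by
  unfold advance
  split <;> grind

theorem flips_add_calls_iterate_advance_le (ω : Source) (t : ℕ) (k : Snapshot S) :
    ((δ.advance ω)^[t] k).flips + ((δ.advance ω)^[t] k).calls ≤ k.flips + k.calls + t := by
  induction t with
  | zero => rfl
  | succ t ih =>
    rw [Function.iterate_succ_apply']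
    have := flips_add_calls_advance_le (δ := δ) ω ((δ.advance ω)^[t] k)
    omega

theorem iterate_advance_congr {ω ω' : Source} (t : ℕ) (k : Snapshot S)
    (hcoin : ∀ i, k.flips ≤ i → ω.coin i = ω'.coin i)
    (hinput : ∀ i, k.calls ≤ i → ω.input i = ω'.input i) :
    (δ.advance ω)^[t] k = (δ.advance ω')^[t] k := by
  induction t generalizing k with
  | zero => rfl
  | succ t ih =>
    have hle : k.flips ≤ (δ.advance ω k).flips ∧ k.calls ≤ (δ.advance ω k).calls := by
      unfold advance
      split <;> simp
    have heq : δ.advance ω k = δ.advance ω' k := by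
      unfold advance
      rw [hcoin _ le_rfl, hinput _ le_rfl]
    rw [Function.iterate_succ_apply, Function.iterate_succ_apply, ← heq]
    exact ih _ (fun i hi => hcoin i (hle.1.trans hi)) fun i hi => hinput i (hle.2.trans hi)

theorem iterate_advance_update_coin (ω : Source) (v : Bool) (t : ℕ) (s : S) (f c : ℕ) :
    (δ.advance (Function.update ω.coin f v, ω.input))^[t] ⟨s, f + 1, c⟩ =
      (δ.advance ω)^[t] ⟨s, f + 1, c⟩ :=
  iterate_advance_congr t _ (fun _ hi => Function.update_of_ne (Nat.ne_of_gt hi) _ _)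
    fun _ _ => rfl

theorem iterate_advance_update_input (ω : Source) (v : Bool) (t : ℕ) (s : S) (f c : ℕ) :
    (δ.advance (ω.coin, Function.update ω.input c v))^[t] ⟨s, f, c + 1⟩ =
      (δ.advance ω)^[t] ⟨s, f, c + 1⟩ :=
  iterate_advance_congr t _ (fun _ _ => rfl)
    fun _ hi => Function.update_of_ne (Nat.ne_of_gt hi) _ _

theorem measurableSet_iterate_advance_mem (t : ℕ) (k : Snapshot S) (B : Set (Snapshot S)) :
    MeasurableSet {ω | (δ.advance ω)^[t] k ∈ B} := by
  induction t generalizing k with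
  | zero => exact .const (k ∈ B)
  | succ t ih =>
    simp only [Function.iterate_succ_apply]
    unfold advance
    rcases δ k.state with _ | next | next
    · exact ih k
    · exact measurableSet_mem_apply (fun b => ih ⟨next b, k.flips + 1, k.calls⟩)
        (X := fun ω : Source => ω.coin k.flips) (by fun_prop)
    · exact measurableSet_mem_apply (fun b => ih ⟨next b, k.flips, k.calls + 1⟩)
        (X := fun ω : Source => ω.input k.calls) (by fun_prop)

theorem measurableSet_haltingEvent (E : Set (ℕ × ℕ)) (k : Snapshot S) :
    MeasurableSet (δ.haltingEvent E k) := by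
  simp only [haltingEvent, Set.ofPred_exists]
  exact .iUnion fun t => measurableSet_iterate_advance_mem t k _

/-! ### Moments along a run -/

variable {q : ℕ → unitInterval}

theorem mean_mono {Φ Ψ : Snapshot S → ℝ} (h : Φ ≤ Ψ) : δ.mean q Φ ≤ δ.mean q Ψ := by
  intro k
  unfold mean
  have hq := (q k.calls).2
  split
  · exact h k
  · gcongr <;> exact h _
  · exact add_le_add (mul_le_mul_of_nonneg_left (h _) hq.1)
      (mul_le_mul_of_nonneg_left (h _) (sub_nonneg.2 hq.2))

theorem mean_const_mul (a : ℝ) (Φ : Snapshot S → ℝ) (k : Snapshot S) :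
    δ.mean q (fun k => a * Φ k) k = a * δ.mean q Φ k := by
  unfold mean
  split <;> ring

theorem mean_one_sub (Φ : Snapshot S → ℝ) (k : Snapshot S) :
    δ.mean q (fun k => 1 - Φ k) k = 1 - δ.mean q Φ k := by
  unfold mean
  split <;> ring

theorem measureReal_iterate_advance_succ_mem (t : ℕ) (k : Snapshot S) (B : Set (Snapshot S)) :
    (variableSource q).real {ω | (δ.advance ω)^[t + 1] k ∈ B} =
      δ.mean q (fun k => (variableSource q).real {ω | (δ.advance ω)^[t] k ∈ B}) k := by
  simp only [Function.iterate_succ_apply]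
  unfold advance mean
  rcases δ k.state with n | next | next
  · rfl
  · refine measureReal_variableSource_coin q
      (A := fun b => {ω | (δ.advance ω)^[t] ⟨next b, k.flips + 1, k.calls⟩ ∈ B})
      (fun b => measurableSet_iterate_advance_mem _ _ _) fun b ω v => ?_
    simp only [Set.mem_ofPred_eq, iterate_advance_update_coin]
  · refine measureReal_variableSource_input q
      (A := fun b => {ω | (δ.advance ω)^[t] ⟨next b, k.flips, k.calls + 1⟩ ∈ B})
      (fun b => measurableSet_iterate_advance_mem _ _ _) fun b ω v => ?_
    simp only [Set.mem_ofPred_eq, iterate_advance_update_input]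

theorem measureReal_iterate_advance_mem_le {Φ : Snapshot S → ℝ} {ρ : ℝ} {B : Set (Snapshot S)}
    (hρ : 0 ≤ ρ) (hΦ : 0 ≤ Φ) (hB : ∀ k ∈ B, 1 ≤ Φ k)
    (hmean : ∀ k, δ.mean q Φ k ≤ ρ * Φ k) (t : ℕ) (k : Snapshot S) :
    (variableSource q).real {ω | (δ.advance ω)^[t] k ∈ B} ≤ ρ ^ t * Φ k := by
  induction t generalizing k with
  | zero =>
    by_cases hk : k ∈ B
    · simpa [hk] using hB k hk
    · simpa [hk] using hΦ k
  | succ t ih =>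
    calc _ = δ.mean q (fun k => (variableSource q).real {ω | (δ.advance ω)^[t] k ∈ B}) k :=
          measureReal_iterate_advance_succ_mem t k B
      _ ≤ δ.mean q (fun k => ρ ^ t * Φ k) k := mean_mono ih k
      _ = ρ ^ t * δ.mean q Φ k := mean_const_mul _ _ _
      _ ≤ ρ ^ t * (ρ * Φ k) := mul_le_mul_of_nonneg_left (hmean k) (pow_nonneg hρ t)
      _ = ρ ^ (t + 1) * Φ k := by ring

theorem measureReal_haltingEvent_le {Φ : Snapshot S → ℝ} {E : Set (ℕ × ℕ)} (hΦ : 0 ≤ Φ)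
    (hE : ∀ k ∈ δ.haltedIn E, 1 ≤ Φ k) (hmean : ∀ k, δ.mean q Φ k ≤ Φ k) (k : Snapshot S) :
    (variableSource q).real (δ.haltingEvent E k) ≤ Φ k := by
  have hunion : δ.haltingEvent E k = ⋃ t, {ω | (δ.advance ω)^[t] k ∈ δ.haltedIn E} := by
    simp only [haltingEvent, Set.ofPred_exists]
  rw [measureReal_def, hunion, (monotone_iterate_advance_mem_haltedIn E k).measure_iUnion]
  refine ENNReal.toReal_le_of_le_ofReal (hΦ k) (iSup_le fun t => ?_)
  rw [ENNReal.le_ofReal_iff_toReal_le (measure_ne_top _ _) (hΦ k)]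
  simpa only [one_pow, one_mul, measureReal_def] using
    measureReal_iterate_advance_mem_le zero_le_one hΦ hE (by simpa only [one_mul] using hmean) t k

/-- Applying the upper bound to `E` and `Φ` and to the complement of `E` and `1 - Φ` leaves no
room. -/
theorem measureReal_haltingEvent_eq {Φ : Snapshot S → ℝ} {E : Set (ℕ × ℕ)}
    (hΦ : ∀ k, Φ k ∈ Set.Icc 0 1) (hE : ∀ k ∈ δ.haltedIn E, Φ k = 1)
    (hE' : ∀ k ∈ δ.haltedIn Eᶜ, Φ k = 0) (hmean : ∀ k, δ.mean q Φ k = Φ k) {k : Snapshot S}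
    (hae : ∀ᵐ ω ∂variableSource q, ω ∈ δ.haltingEvent .univ k) :
    (variableSource q).real (δ.haltingEvent E k) = Φ k := by
  have hle := measureReal_haltingEvent_le (q := q) (fun k => (hΦ k).1) (fun k hk => (hE k hk).ge)
    (fun k => (hmean k).le) k
  have hle' := measureReal_haltingEvent_le (q := q) (Φ := fun k => 1 - Φ k) (E := Eᶜ)
    (fun k => sub_nonneg.2 (hΦ k).2) (fun k hk => by simp [hE' k hk])
    (fun k => by rw [mean_one_sub, hmean]) k
  have hcover : 1 ≤ (variableSource q).real (δ.haltingEvent E k) +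
      (variableSource q).real (δ.haltingEvent Eᶜ k) := by
    rw [← probReal_univ (μ := variableSource q)]
    refine (ENNReal.toReal_mono (measure_ne_top _ _) (measure_mono_ae ?_)).trans
      (measureReal_union_le _ _)
    filter_upwards [hae] with ω hω _
    obtain ⟨t, n, hn, -⟩ := hω
    by_cases h : (n, ((δ.advance ω)^[t] k).calls) ∈ E
    · exact .inl ⟨t, n, hn, h⟩
    · exact .inr ⟨t, n, hn, h⟩
  linarith

end Flowchart

/-! ### Programs that carry out a flowchart -/

theorem step_eq_self {p : Program} {ω : Source} {k : Config} {r : ℕ}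
    (hr : p[k.pc]? = some (.ret r)) : step p ω k = k := by
  simp only [step, hr, Instr.exec]

theorem haltsWith_unique {p : Program} {ω : Source} {n n' f f' c c' : ℕ}
    (h : HaltsWith p ω n f c) (h' : HaltsWith p ω n' f' c') : n = n' ∧ f = f' ∧ c = c' := by
  obtain ⟨t, r, hr, rfl, rfl, rfl⟩ := h
  obtain ⟨t', r', hr', rfl, rfl, rfl⟩ := h'
  have hfix {s d : ℕ} {x : ℕ} (hx : p[(run p ω s).pc]? = some (.ret x)) :
      run p ω (d + s) = run p ω s := by
    rw [run, Function.iterate_add_apply]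
    exact Function.iterate_fixed (step_eq_self hx) d
  have hrun : run p ω t = run p ω t' := by
    rcases le_total t t' with htt | htt <;> obtain ⟨d, rfl⟩ := Nat.exists_eq_add_of_le' htt
    exacts [(hfix hr).symm, hfix hr']
  rw [hrun] at hr ⊢
  obtain rfl : r = r' := by simpa using hr.symm.trans hr'
  exact ⟨rfl, rfl, rfl⟩

section Realizes

variable {S : Type*}

/-- The program `p`, started in the configuration `k`, comes to represent the snapshot `x`, the
relation `Rep` telling which configurations represent a snapshot. -/
def Leads (p : Program) (Rep : Snapshot S → Config → Prop) (ω : Source) (k : Config)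
    (x : Snapshot S) : Prop :=
  ∃ t, Rep x ((step p ω)^[t] k)

theorem Leads.of_iterate {p : Program} {Rep : Snapshot S → Config → Prop} {ω : Source}
    {k : Config} {x : Snapshot S} (t : ℕ) (h : Leads p Rep ω ((step p ω)^[t] k) x) :
    Leads p Rep ω k x := by
  obtain ⟨u, h⟩ := h
  exact ⟨u + t, by rwa [Function.iterate_add_apply]⟩

/-- The program `p` carries out the flowchart `δ` from the state `s₀` on. One move of the flowchart
may take several steps of the program. -/
structure Realizes (p : Program) (δ : Flowchart S) (s₀ : S) (Rep : Snapshot S → Config → Prop) :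
    Prop where
  init : ∀ ω, Leads p Rep ω .init ⟨s₀, 0, 0⟩
  advance : ∀ ω x k, Rep x k → Leads p Rep ω k (δ.advance ω x)
  halt : ∀ x k n, Rep x k → δ x.state = .halt n →
    ∃ r, p[k.pc]? = some (.ret r) ∧ k.counter r = n
  cost : ∀ x k, Rep x k → k.flips = x.flips ∧ k.calls = x.calls

/-- The number of moves has an exponential tail when the flowchart starts in `k`. -/
def Flowchart.HasExponentialTail (δ : Flowchart S) (q : ℕ → unitInterval) (k : Snapshot S) :
    Prop :=
  ∃ K ρ : ℝ, 0 ≤ ρ ∧ ρ < 1 ∧ ∀ m : ℕ,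
    (variableSource q).real {ω | (δ.advance ω)^[m] k ∉ δ.haltedIn .univ} ≤ K * ρ ^ m

theorem Flowchart.HasExponentialTail.ae_mem_haltingEvent {δ : Flowchart S}
    {q : ℕ → unitInterval} {k : Snapshot S} (h : δ.HasExponentialTail q k) :
    ∀ᵐ ω ∂variableSource q, ω ∈ δ.haltingEvent .univ k := by
  obtain ⟨K, ρ, hρ, hρ', h⟩ := h
  have hlim : Filter.Tendsto (fun t => K * ρ ^ t) .atTop (nhds 0) := by
    simpa using (tendsto_pow_atTop_nhds_zero_of_lt_one hρ hρ').const_mul K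
  have hsub (t : ℕ) : (δ.haltingEvent .univ k)ᶜ ⊆
      {ω | (δ.advance ω)^[t] k ∉ δ.haltedIn .univ} := fun ω hω h => hω ⟨t, h⟩
  have hle (t : ℕ) := (measureReal_mono (μ := variableSource q) (hsub t)).trans (h t)
  rw [ae_iff, ← measureReal_eq_zero_iff]
  exact (ge_of_tendsto' hlim hle).antisymm measureReal_nonneg

theorem Flowchart.hasExponentialTail_of_mean_le {δ : Flowchart S} {q : ℕ → unitInterval}
    {V : Snapshot S → ℝ} {ρ : ℝ} (hρ : 0 ≤ ρ) (hρ' : ρ < 1) (hV : 0 ≤ V)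
    (hV' : ∀ k ∉ δ.haltedIn .univ, 1 ≤ V k) (hmean : ∀ k, δ.mean q V k ≤ ρ * V k)
    (k : Snapshot S) : δ.HasExponentialTail q k :=
  ⟨V k, ρ, hρ, hρ', fun m => by
    rw [mul_comm]
    exact measureReal_iterate_advance_mem_le (B := (δ.haltedIn .univ)ᶜ) hρ hV hV' hmean m k⟩

namespace Realizes

variable {p : Program} {δ : Flowchart S} {s₀ : S} {Rep : Snapshot S → Config → Prop}

theorem leads_iterate_advance (h : Realizes p δ s₀ Rep) (ω : Source) (t : ℕ) :
    Leads p Rep ω .init ((δ.advance ω)^[t] ⟨s₀, 0, 0⟩) := by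
  induction t with
  | zero => exact h.init ω
  | succ t ih =>
    obtain ⟨u, hu⟩ := ih
    rw [Function.iterate_succ_apply']
    exact .of_iterate u (h.advance ω _ _ hu)

theorem haltsWith (h : Realizes p δ s₀ Rep) {ω : Source} {t n : ℕ}
    (hn : δ ((δ.advance ω)^[t] ⟨s₀, 0, 0⟩).state = .halt n) :
    HaltsWith p ω n ((δ.advance ω)^[t] ⟨s₀, 0, 0⟩).flips
      ((δ.advance ω)^[t] ⟨s₀, 0, 0⟩).calls := by
  obtain ⟨u, hrep⟩ := h.leads_iterate_advance ω t
  obtain ⟨r, hr, hrn⟩ := h.halt _ _ _ hrep hn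
  exact ⟨u, r, hr, hrn, h.cost _ _ hrep⟩

theorem exists_haltsWith_iff (h : Realizes p δ s₀ Rep) {ω : Source}
    (hω : ω ∈ δ.haltingEvent .univ ⟨s₀, 0, 0⟩) (E : Set (ℕ × ℕ)) :
    (∃ n f c, HaltsWith p ω n f c ∧ (n, c) ∈ E) ↔ ω ∈ δ.haltingEvent E ⟨s₀, 0, 0⟩ := by
  constructor
  · rintro ⟨n, f, c, hnfc, hE⟩
    obtain ⟨t, n', hn', -⟩ := hω
    obtain ⟨rfl, rfl, rfl⟩ := haltsWith_unique hnfc (h.haltsWith hn')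
    exact ⟨t, n, hn', hE⟩
  · rintro ⟨t, n, hn, hE⟩
    exact ⟨n, _, _, h.haltsWith hn, hE⟩

theorem stronglySimulates (h : Realizes p δ s₀ Rep) {law : ℝ → ℕ → ℝ}
    (htail : ∀ lam : unitInterval, 0 < lam → lam < 1 →
      δ.HasExponentialTail (fun _ => lam) ⟨s₀, 0, 0⟩)
    (hlaw : ∀ lam : unitInterval, 0 < lam → lam < 1 → ∀ n,
      (source lam).real (δ.haltingEvent {e | e.1 = n} ⟨s₀, 0, 0⟩) = law lam n) :
    StronglySimulates p law := by
  intro lam h0 h1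
  have hae := (htail lam h0 h1).ae_mem_haltingEvent
  refine ⟨?_, fun n => ?_, ?_⟩
  · filter_upwards [hae] with ω hω
    obtain ⟨t, n, hn, -⟩ := hω
    exact ⟨n, _, _, h.haltsWith hn⟩
  · rw [← hlaw lam h0 h1, ofReal_measureReal]
    refine measure_congr ?_
    filter_upwards [hae] with ω hω
    refine propext (Iff.trans ?_ (h.exists_haltsWith_iff hω {e | e.1 = n}))
    exact ⟨fun ⟨f, c, hfc⟩ => ⟨n, f, c, hfc, rfl⟩, fun ⟨_, f, c, hfc, hn⟩ => ⟨f, c, hn ▸ hfc⟩⟩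
  · obtain ⟨K, ρ, hρ, hρ', hm⟩ := htail lam h0 h1
    refine ⟨K, ρ, hρ, hρ', fun m => ?_⟩
    rw [← source_eq_variableSource] at hm
    refine le_trans (measure_mono ?_) <|
      (ofReal_measureReal (μ := source lam)).symm.trans_le (ENNReal.ofReal_le_ofReal (hm m))
    rintro ω hω ⟨n, hn, -⟩
    exact hω ⟨n, _, _, h.haltsWith hn, by
      simpa using Flowchart.flips_add_calls_iterate_advance_le (δ := δ) ω m ⟨s₀, 0, 0⟩⟩

end Realizes

end Realizes

/-! ### The flowchart of a von Neumann machine -/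

/-- How a von Neumann machine treats the entries of a trial. -/
structure Rule where
  /-- whether a trial of size `0` succeeds -/
  acceptsEmpty : Bool
  /-- the first bit of a new entry that differs from the stored number must be this one, or else the
  trial fails -/
  passBit : Bool
  /-- the bits to be stored, given those of the stored number and of the new entry -/
  store : List Bool → List Bool → List Bool

/-- Every entry must be larger than the preceding one. -/
def sortedRule : Rule := ⟨true, true, fun _ new => new⟩

/-- Every entry must be smaller than the first one. -/
def firstLargestRule : Rule := ⟨false, false, fun old _ => old⟩

/-- The states of a von Neumann machine between random choices. -/
inductive TrialState
  /-- the generator has succeeded `N` times -/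
  | draw (N : ℕ)
  /-- a new entry is being compared with the stored number: `N` is the size of the trial, `m` the
  number of entries to follow, `u` the common leading bits and `u ++ v` the known bits of the stored
  number -/
  | compare (N m : ℕ) (u v : List Bool)
  /-- the trial, of size `N`, has succeeded -/
  | accept (N : ℕ)

/-- The state in which `m` entries are to be drawn, the number with known bits `s` being stored. -/
def TrialState.entry (N : ℕ) : ℕ → List Bool → TrialState
  | 0, _ => .accept N
  | m + 1, s => .compare N m [] s

namespace Rule

/-- The state after the first failure of the generator. The first entry is merely stored, with no
bit known yet. -/
def afterDraw (r : Rule) : ℕ → TrialState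
  | 0 => if r.acceptsEmpty then .accept 0 else .draw 0
  | N + 1 => .entry (N + 1) N []

/-- The state after the first bit `!a` of the new entry that differs from the bit `a` of the stored
number `u ++ a :: v`. -/
def afterCompare (r : Rule) (N m : ℕ) (u : List Bool) (a : Bool) (v : List Bool) : TrialState :=
  if a = r.passBit then .draw 0 else .entry N m (r.store (u ++ a :: v) (u ++ [!a]))

/-- The flowchart of the von Neumann machine with the given rule. -/
def flowchart (r : Rule) : Flowchart TrialState
  | .draw N => .call fun b => if b then .draw (N + 1) else r.afterDraw N
  | .compare N m u [] => .flip fun b => .compare N m u [b]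
  | .compare N m u (a :: v) =>
      .flip fun b => if b = a then .compare N m (u ++ [a]) v else r.afterCompare N m u a v
  | .accept N => .halt N

end Rule

/-! ### The machines carry out their flowcharts -/

/-- What the registers of the program `p` hold in a given state. -/
def TrialState.Holds (p : Program) (k : Config) : TrialState → Prop
  | .draw N => k.pc = 3 ∧ k.counter 0 = N ∧ k.counter 1 = N ∧ k.string 0 = []
  | .compare N m u v => k.pc = 11 ∧ k.counter 0 = N ∧ k.counter 1 = m ∧ k.counter 2 = u.length ∧
      k.string 0 = u ++ v
  | .accept N => p[k.pc]? = some (.ret 0) ∧ k.counter 0 = N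

/-- The relation between the snapshots of the flowchart and the configurations of the program. -/
def Represents (p : Program) (x : Snapshot TrialState) (k : Config) : Prop :=
  x.state.Holds p k ∧ k.flips = x.flips ∧ k.calls = x.calls

/-- The first 17 instructions of both machines, up to three labels. -/
def prologue (emptyLabel acceptLabel oneLabel : ℕ) : Program :=
  [.zero 0, .zero 1, .clear 0, .call 5, .goto 8, .inc 0, .inc 1, .goto 3, .decOrJump 1 emptyLabel,
    .decOrJump 1 acceptLabel, .zero 2, .read 0 2 17 oneLabel, .flip 15, .push 0 false, .goto 11,
    .push 0 true, .goto 11]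

section Machines

attribute [local simp] step Instr.exec Represents TrialState.Holds TrialState.entry prologue
  Flowchart.advance Rule.flowchart Rule.afterDraw Rule.afterCompare

section Prologue

variable {e a o : ℕ} {tail : Program} {p : Program} {ω : Source} {N m : ℕ} {u s : List Bool}
  {k : Config}

theorem leads_draw (hp : p = prologue e a o ++ tail) (hk : k.pc = 0) :
    Leads p (Represents p) ω k ⟨.draw 0, k.flips, k.calls⟩ := by
  subst hp
  obtain ⟨pc, x, y, f, c⟩ := k
  obtain rfl : pc = 0 := hk
  exact ⟨3, by simp⟩

theorem leads_entry (hp : p = prologue e a o ++ tail) (ha : p[a]? = some (.ret 0))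
    (hk : k.pc = 9) (hN : k.counter 0 = N) (hm : k.counter 1 = m) (hs : k.string 0 = s) :
    Leads p (Represents p) ω k ⟨.entry N m s, k.flips, k.calls⟩ := by
  subst hp hN hm hs
  obtain ⟨pc, x, y, f, c⟩ := k
  obtain rfl : pc = 9 := hk
  rcases hm : x 1 with _ | m
  · exact ⟨1, by simpa [hm] using ha⟩
  · exact ⟨2, by simp [hm]⟩

theorem leads_afterDraw {r : Rule} (hp : p = prologue e a o ++ tail)
    (ha : p[a]? = some (.ret 0)) (he : e = if r.acceptsEmpty then a else 0)
    (hk : k.pc = 8) (hN : k.counter 0 = N) (hN' : k.counter 1 = N) (hs : k.string 0 = []) :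
    Leads p (Represents p) ω k ⟨r.afterDraw N, k.flips, k.calls⟩ := by
  obtain ⟨pc, x, y, f, c⟩ := k
  obtain rfl : pc = 8 := hk
  simp only at hN hN' hs
  have h8 : p[8]? = some (.decOrJump 1 e) := by simp [hp]
  rcases N with _ | N
  · cases hr : r.acceptsEmpty
    · exact .of_iterate 1 <| by
        simpa [h8, hN', he, hr] using leads_draw (k := ⟨0, x, y, f, c⟩) hp rfl
    · exact ⟨1, by simpa [h8, hN', hN, he, hr] using ha⟩
  · exact .of_iterate 1 <| by
      simpa [h8, hN'] using
        leads_entry (k := ⟨9, Function.update x 1 N, y, f, c⟩) hp ha rfl (by simpa) (by simp) hs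

theorem leads_advance_draw {r : Rule} (hp : p = prologue e a o ++ tail)
    (ha : p[a]? = some (.ret 0)) (he : e = if r.acceptsEmpty then a else 0) {f c : ℕ}
    (hk : Represents p ⟨.draw N, f, c⟩ k) :
    Leads p (Represents p) ω k (r.flowchart.advance ω ⟨.draw N, f, c⟩) := by
  obtain ⟨pc, x, y, f', c'⟩ := k
  obtain ⟨⟨rfl, rfl, hN, hs⟩, rfl, rfl⟩ := hk
  simp only at hN hs
  cases hb : ω.input c'
  · refine .of_iterate 2 ?_
    simpa [hp, hb] using
      leads_afterDraw (k := ⟨8, x, y, f', c' + 1⟩) hp ha he rfl rfl hN hs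
  · exact ⟨4, by simp [hp, hN, hs, hb]⟩

theorem leads_advance_compare_nil {r : Rule} (hp : p = prologue e a o ++ tail) {f c : ℕ}
    (hk : Represents p ⟨.compare N m u [], f, c⟩ k) :
    Leads p (Represents p) ω k (r.flowchart.advance ω ⟨.compare N m u [], f, c⟩) := by
  obtain ⟨pc, x, y, f', c'⟩ := k
  obtain ⟨⟨rfl, rfl, rfl, hu, hs⟩, rfl, rfl⟩ := hk
  simp only at hu hs
  cases hb : ω.coin f' <;> exact ⟨4, by simp [hp, hu, hs, hb]⟩

theorem realizes_of_prologue {r : Rule} (hp : p = prologue e a o ++ tail)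
    (ha : p[a]? = some (.ret 0)) (he : e = if r.acceptsEmpty then a else 0)
    (hcompare : ∀ ω N m u d v f c k, Represents p ⟨.compare N m u (d :: v), f, c⟩ k →
      Leads p (Represents p) ω k (r.flowchart.advance ω ⟨.compare N m u (d :: v), f, c⟩)) :
    Realizes p r.flowchart (.draw 0) (Represents p) where
  init ω := leads_draw hp rfl
  advance
    | ω, ⟨.draw N, f, c⟩, k, hk => leads_advance_draw hp ha he hk
    | ω, ⟨.compare N m u [], f, c⟩, k, hk => leads_advance_compare_nil hp hk
    | ω, ⟨.compare N m u (d :: v), f, c⟩, k, hk => hcompare ω N m u d v f c k hk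
    | ω, ⟨.accept N, f, c⟩, k, hk => ⟨0, hk⟩
  halt
    | ⟨.accept N, f, c⟩, k, n, hk, h => by
      cases h
      exact ⟨0, hk.1⟩
    | ⟨.compare N m u [], f, c⟩, k, n, _, h => by cases h
    | ⟨.compare N m u (d :: v), f, c⟩, k, n, _, h => by cases h
    | ⟨.draw N, f, c⟩, k, n, _, h => by cases h
  cost x k hk := hk.2

end Prologue

theorem sortedMachine_realizes : Realizes sortedMachine sortedRule.flowchart (.draw 0)
    (Represents sortedMachine) := by
  have hp : sortedMachine = prologue 27 27 23 ++ sortedMachine.drop 17 := rfl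
  refine realizes_of_prologue hp rfl rfl fun ω N m u d v f c k hk => ?_
  obtain ⟨pc, x, y, f', c'⟩ := k
  obtain ⟨⟨rfl, rfl, rfl, hu, hs⟩, rfl, rfl⟩ := hk
  simp only at hu hs
  cases d <;> cases hb : ω.coin f'
  · exact ⟨4, by simp [sortedMachine, hu, hs, hb]⟩
  · refine .of_iterate 5 ?_
    simpa [sortedMachine, hu, hs, hb, sortedRule] using
      leads_entry (k := ⟨9, x, Function.update y 0 (u ++ [true]), f' + 1, c'⟩)
        hp rfl rfl rfl rfl rfl
  · refine .of_iterate 3 ?_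
    simpa [sortedMachine, hu, hs, hb, sortedRule] using
      leads_draw (k := ⟨0, x, y, f' + 1, c'⟩) hp rfl
  · exact ⟨4, by simp [sortedMachine, hu, hs, hb]⟩

theorem firstLargestMachine_realizes : Realizes firstLargestMachine firstLargestRule.flowchart
    (.draw 0) (Represents firstLargestMachine) := by
  have hp : firstLargestMachine = prologue 0 24 20 ++ firstLargestMachine.drop 17 := rfl
  refine realizes_of_prologue hp rfl rfl fun ω N m u d v f c k hk => ?_
  obtain ⟨pc, x, y, f', c'⟩ := k
  obtain ⟨⟨rfl, rfl, rfl, hu, hs⟩, rfl, rfl⟩ := hk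
  simp only at hu hs
  cases d <;> cases hb : ω.coin f'
  · exact ⟨4, by simp [firstLargestMachine, hu, hs, hb]⟩
  · refine .of_iterate 2 ?_
    simpa [firstLargestMachine, hu, hs, hb, firstLargestRule] using
      leads_draw (k := ⟨0, x, y, f' + 1, c'⟩) hp rfl
  · refine .of_iterate 3 ?_
    simpa [firstLargestMachine, hu, hs, hb, firstLargestRule] using
      leads_entry (k := ⟨9, x, y, f' + 1, c'⟩) hp rfl rfl rfl rfl hs
  · exact ⟨4, by simp [firstLargestMachine, hu, hs, hb]⟩

end Machines

/-! ### Exponential tails -/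

/-- Parameters of a function of the states that decreases on average by the factor `θ⁻¹` per move.
An entry to be compared counts for a factor `β`, which is chosen so that a comparison after which
another entry follows is exactly balanced; the values at the draws are `restart` for the first
call of a trial and `draw * β ^ N` after `N ≥ 2` successes. -/
structure Potential (lam : ℝ) where
  (θ β restart compare draw : ℝ)
  one_lt_θ : 1 < θ
  one_le_β : 1 ≤ β
  sq_mul_add_one : θ ^ 2 * (β + 1) = 2 * β
  one_lt_restart : 1 < restart
  restart_lt_compare : restart < compare
  compare_lt_draw : compare < draw
  first_call : θ * (lam + (1 - lam) * restart) ≤ restart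
  second_call : θ * (lam * (draw * β ^ 2)) ≤ 1
  later_call : θ * (lam * β * draw + (1 - lam) * (θ * compare)) ≤ draw
  failing_comparison : θ * (θ * compare + restart) ≤ 2 * compare

theorem nonempty_potential {lam : ℝ} (h0 : 0 < lam) (h1 : lam < 1) :
    Nonempty (Potential lam) := by
  -- The other inequalities are strict for `θ = β = 1`, hence persist for `θ` slightly above `1`.
  obtain ⟨A, hA, hA'⟩ := exists_between ((one_lt_inv₀ h0).2 h1)
  obtain ⟨C, hC, hCA⟩ := exists_between hA
  obtain ⟨d, hd, hdC⟩ := exists_between hC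
  have hlamA : lam * A < 1 := by
    simpa [h0.ne'] using mul_lt_mul_of_pos_left hA' h0
  let β : ℝ → ℝ := fun θ => θ ^ 2 / (2 - θ ^ 2)
  have hβ : ContinuousAt β 1 := by
    refine ContinuousAt.div ?_ ?_ ?_ <;> first | fun_prop | norm_num
  have hβ1 : β 1 = 1 := by norm_num [β]
  have eventually_lt {f : ℝ → ℝ} (b : ℝ) (hf : ContinuousAt f 1) (hfb : f 1 < b) :
      ∀ᶠ θ in nhdsWithin 1 (Set.Ioi 1), f θ < b :=
    (hf.tendsto.mono_left nhdsWithin_le_nhds).eventually_lt_const hfb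
  obtain ⟨θ, hθ, hθ2, hfirst, hsecond, hlater, hfail⟩ :=
    ((eventually_mem_nhdsWithin (a := (1 : ℝ)) (s := Set.Ioi 1)).and <|
      (eventually_lt (f := fun θ => θ ^ 2) 2 (by fun_prop) (by norm_num)).and <|
      (eventually_lt (f := fun θ => θ * (lam + (1 - lam) * d)) d (by fun_prop)
        (by nlinarith)).and <|
      (eventually_lt (f := fun θ => θ * (lam * (A * β θ ^ 2))) 1 (by fun_prop)
        (by simpa [hβ1])).and <|
      (eventually_lt (f := fun θ => θ * (lam * β θ * A + (1 - lam) * (θ * C))) A (by fun_prop)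
        (by simp only [hβ1]; nlinarith)).and <|
      eventually_lt (f := fun θ => θ * (θ * C + d)) (2 * C) (by fun_prop) (by linarith)).exists
  have hpos : 0 < 2 - θ ^ 2 := sub_pos.2 hθ2
  exact ⟨{
    θ, β := β θ, restart := d, compare := C, draw := A
    one_lt_θ := hθ
    one_le_β := by
      rw [one_le_div hpos]
      nlinarith [Set.mem_Ioi.1 hθ]
    sq_mul_add_one := by
      simp only [β]
      field_simp
      ring
    one_lt_restart := hd
    restart_lt_compare := hdC
    compare_lt_draw := hCA
    first_call := hfirst.le
    second_call := hsecond.le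
    later_call := hlater.le
    failing_comparison := hfail.le }⟩

namespace Potential

variable {lam : ℝ} (P : Potential lam)

/-- The value of a potential in a state. -/
def value : TrialState → ℝ
  | .draw 0 => P.restart
  | .draw 1 => 1
  | .draw (N + 2) => P.draw * P.β ^ (N + 2)
  | .compare _ m _ [] => P.θ * P.compare * P.β ^ m
  | .compare _ m _ (_ :: _) => P.compare * P.β ^ m
  | .accept _ => 0

theorem θ_pos : 0 < P.θ := zero_lt_one.trans P.one_lt_θ

theorem β_pos : 0 < P.β := zero_lt_one.trans_le P.one_le_β

theorem compare_pos : 0 < P.compare := by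
  linarith [P.one_lt_restart, P.restart_lt_compare]

theorem one_le_value_draw (N : ℕ) : 1 ≤ P.value (.draw N) := by
  match N with
  | 0 => exact P.one_lt_restart.le
  | 1 => exact le_rfl
  | N + 2 =>
    have hdraw : 1 ≤ P.draw := by
      linarith [P.one_lt_restart, P.restart_lt_compare, P.compare_lt_draw]
    exact one_le_mul_of_one_le_of_one_le hdraw (one_le_pow₀ P.one_le_β)

theorem compare_mul_le_value_compare (N m : ℕ) (u v : List Bool) :
    P.compare * P.β ^ m ≤ P.value (.compare N m u v) := by
  rcases v with _ | _
  · rw [value, mul_assoc]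
    exact le_mul_of_one_le_left (mul_pos P.compare_pos (pow_pos P.β_pos m)).le P.one_lt_θ.le
  · exact le_rfl

theorem value_compare_le (N m : ℕ) (u v : List Bool) :
    P.value (.compare N m u v) ≤ P.θ * P.compare * P.β ^ m := by
  rcases v with _ | _
  · exact le_rfl
  · rw [mul_assoc]
    exact P.compare_mul_le_value_compare N m u [] |>.trans_eq (mul_assoc ..)

theorem β_mul_value_entry_le (N m : ℕ) (s : List Bool) :
    P.β * P.value (.entry N m s) ≤ P.θ * P.compare * P.β ^ m := by
  rcases m with _ | m
  · simpa [TrialState.entry, value] using (mul_pos P.θ_pos P.compare_pos).le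
  · calc P.β * P.value (.compare N m [] s) ≤ P.β * (P.θ * P.compare * P.β ^ m) :=
          mul_le_mul_of_nonneg_left (P.value_compare_le N m [] s) P.β_pos.le
      _ = P.θ * P.compare * P.β ^ (m + 1) := by ring

theorem θ_mul_value_compare_add_le (r : Rule) (N m : ℕ) (u : List Bool) (a : Bool)
    (v : List Bool) :
    P.θ * (P.value (.compare N m (u ++ [a]) v) + P.value (r.afterCompare N m u a v)) ≤
      2 * P.value (.compare N m u (a :: v)) := by
  have hcompare := P.value_compare_le N m (u ++ [a]) v
  have hpow : 1 ≤ P.β ^ m := one_le_pow₀ P.one_le_β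
  have hθ := P.θ_pos
  rw [Rule.afterCompare]
  split
  · have hrestart : P.value (.draw 0) ≤ P.restart * P.β ^ m :=
      le_mul_of_one_le_right (zero_le_one.trans P.one_lt_restart.le) hpow
    calc _ ≤ P.θ * (P.θ * P.compare * P.β ^ m + P.restart * P.β ^ m) := by gcongr
      _ = P.θ * (P.θ * P.compare + P.restart) * P.β ^ m := by ring
      _ ≤ 2 * P.compare * P.β ^ m :=
          mul_le_mul_of_nonneg_right P.failing_comparison (zero_le_one.trans hpow)
      _ = _ := mul_assoc ..
  · have hentry := P.β_mul_value_entry_le N m (r.store (u ++ a :: v) (u ++ [!a]))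
    refine le_of_mul_le_mul_left ?_ P.β_pos
    calc _ = P.θ * (P.β * P.value (.compare N m (u ++ [a]) v) +
            P.β * P.value (.entry N m (r.store (u ++ a :: v) (u ++ [!a])))) := by ring
      _ ≤ P.θ * (P.β * (P.θ * P.compare * P.β ^ m) + P.θ * P.compare * P.β ^ m) := by
          have := P.β_pos
          gcongr
      _ = P.θ ^ 2 * (P.β + 1) * (P.compare * P.β ^ m) := by ring
      _ = P.β * (2 * (P.compare * P.β ^ m)) := by rw [P.sq_mul_add_one]; ring

theorem θ_mul_value_draw_le (r : Rule) (h0 : 0 ≤ lam) (h1 : lam ≤ 1) (N : ℕ) :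
    P.θ * (lam * P.value (.draw (N + 1)) + (1 - lam) * P.value (r.afterDraw N)) ≤
      P.value (.draw N) := by
  have hθ := P.θ_pos
  match N with
  | 0 =>
    have hafter : P.value (r.afterDraw 0) ≤ P.restart := by
      rw [Rule.afterDraw]
      split
      · exact zero_le_one.trans P.one_lt_restart.le
      · exact le_rfl
    calc _ ≤ P.θ * (lam * 1 + (1 - lam) * P.restart) := by gcongr; exact le_rfl
      _ ≤ P.restart := by simpa only [mul_one] using P.first_call
  | 1 => simpa [Rule.afterDraw, TrialState.entry, value] using P.second_call
  | N + 2 =>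
    have hβ : P.β ^ N ≤ P.β ^ (N + 2) := pow_le_pow_right₀ P.one_le_β (by omega)
    have hβ0 := pow_pos P.β_pos (N + 2)
    have hC := P.compare_pos
    calc _ = P.θ * (lam * (P.draw * P.β ^ (N + 3)) +
            (1 - lam) * (P.θ * P.compare * P.β ^ N)) := rfl
      _ ≤ P.θ * (lam * (P.draw * P.β ^ (N + 3)) +
            (1 - lam) * (P.θ * P.compare * P.β ^ (N + 2))) := by gcongr
      _ = P.θ * (lam * P.β * P.draw + (1 - lam) * (P.θ * P.compare)) * P.β ^ (N + 2) := by ring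
      _ ≤ P.draw * P.β ^ (N + 2) := by gcongr; exact P.later_call

end Potential

theorem Rule.mem_haltedIn_flowchart {r : Rule} {E : Set (ℕ × ℕ)} {k : Snapshot TrialState} :
    k ∈ r.flowchart.haltedIn E ↔ ∃ n, k.state = .accept n ∧ (n, k.calls) ∈ E := by
  obtain ⟨_ | ⟨N, m, u, _ | _⟩ | _, f, c⟩ := k <;> simp [Flowchart.haltedIn, Rule.flowchart]

theorem Rule.hasExponentialTail (r : Rule) {lam : unitInterval} (h0 : 0 < lam) (h1 : lam < 1)
    (k : Snapshot TrialState) : r.flowchart.HasExponentialTail (fun _ => lam) k := by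
  obtain ⟨P⟩ := nonempty_potential (lam := lam) h0 h1
  have hone : ∀ k ∉ r.flowchart.haltedIn .univ, 1 ≤ P.value k.state
    | ⟨.draw N, _, _⟩, _ => P.one_le_value_draw N
    | ⟨.compare N m u v, _, _⟩, _ =>
      (one_le_mul_of_one_le_of_one_le (P.one_lt_restart.trans P.restart_lt_compare).le
        (one_le_pow₀ P.one_le_β)).trans (P.compare_mul_le_value_compare N m u v)
    | ⟨.accept N, _, _⟩, hk => (hk ⟨N, rfl, trivial⟩).elim
  refine Flowchart.hasExponentialTail_of_mean_le (V := fun k => P.value k.state) (ρ := P.θ⁻¹)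
    (inv_nonneg.2 P.θ_pos.le) (inv_lt_one_of_one_lt₀ P.one_lt_θ) (fun k => ?_) hone
    (fun k => ?_) k
  · by_cases hk : k ∈ r.flowchart.haltedIn .univ
    · obtain ⟨n, hn, -⟩ := mem_haltedIn_flowchart.1 hk
      simp [hn, Potential.value]
    · exact zero_le_one.trans (hone k hk)
  · rw [le_inv_mul_iff₀ P.θ_pos]
    obtain ⟨_ | ⟨N, m, u, _ | ⟨a, v⟩⟩ | _, f, c⟩ := k
    · exact P.θ_mul_value_draw_le r lam.2.1 lam.2.2 _
    · simp [Flowchart.mean, Rule.flowchart, Potential.value, mul_assoc]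
    · have := P.θ_mul_value_compare_add_le r N m u a v
      cases a <;>
        simp only [Flowchart.mean, Rule.flowchart, reduceIte, Bool.false_eq_true,
          Bool.true_eq_false] <;>
        linarith
    · simp [Flowchart.mean, Rule.flowchart, Potential.value]

/-! ### Averages over dyadic intervals -/

/-- The left end of the dyadic interval of the numbers whose binary expansion begins with `s`. -/
noncomputable def leftEnd : List Bool → ℝ
  | [] => 0
  | b :: s => ((if b then 1 else 0) + leftEnd s) / 2

/-- The length of the dyadic interval of the numbers whose binary expansion begins with `s`. -/
noncomputable def width (s : List Bool) : ℝ := (1 / 2) ^ s.length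

/-- The right end of the dyadic interval of the numbers whose binary expansion begins with `s`. -/
noncomputable def rightEnd (s : List Bool) : ℝ := leftEnd s + width s

theorem width_pos (s : List Bool) : 0 < width s := pow_pos one_half_pos _

theorem leftEnd_lt_rightEnd (s : List Bool) : leftEnd s < rightEnd s :=
  lt_add_of_pos_right _ (width_pos s)

theorem width_append (s t : List Bool) : width (s ++ t) = width s * width t := by
  rw [width, List.length_append, pow_add]
  rfl

theorem leftEnd_append (s t : List Bool) : leftEnd (s ++ t) = leftEnd s + width s * leftEnd t := by
  induction s with
  | nil => simp [leftEnd, width]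
  | cons b s ih =>
    simp only [List.cons_append, leftEnd, ih, width, List.length_cons, pow_succ]
    ring

theorem leftEnd_nonneg (s : List Bool) : 0 ≤ leftEnd s := by
  induction s with
  | nil => exact le_rfl
  | cons b s ih =>
    unfold leftEnd
    positivity

theorem rightEnd_le_one (s : List Bool) : rightEnd s ≤ 1 := by
  induction s with
  | nil => norm_num [rightEnd, leftEnd, width]
  | cons b s ih =>
    simp only [rightEnd, leftEnd, width, List.length_cons, pow_succ] at ih ⊢
    split_ifs <;> linarith

theorem Icc_append_subset (s t : List Bool) :
    Set.Icc (leftEnd (s ++ t)) (rightEnd (s ++ t)) ⊆ Set.Icc (leftEnd s) (rightEnd s) := by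
  refine Set.Icc_subset_Icc ?_ ?_
  · rw [leftEnd_append]
    exact le_add_of_nonneg_right (mul_nonneg (width_pos s).le (leftEnd_nonneg t))
  · rw [rightEnd, leftEnd_append, width_append, add_assoc, ← mul_add]
    exact add_le_add_right (mul_le_of_le_one_right (width_pos s).le (rightEnd_le_one t)) _

theorem width_concat (s : List Bool) (b : Bool) : width (s ++ [b]) = width s / 2 := by
  rw [width_append, width, width, List.length_singleton]
  ring

theorem leftEnd_concat_false (s : List Bool) : leftEnd (s ++ [false]) = leftEnd s := by
  simp [leftEnd_append, leftEnd]

theorem leftEnd_concat_true (s : List Bool) : leftEnd (s ++ [true]) = leftEnd s + width s / 2 := by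
  simp [leftEnd_append, leftEnd, div_eq_mul_inv]

theorem rightEnd_concat_false (s : List Bool) :
    rightEnd (s ++ [false]) = leftEnd s + width s / 2 := by
  rw [rightEnd, leftEnd_concat_false, width_concat]

theorem rightEnd_concat_true (s : List Bool) : rightEnd (s ++ [true]) = rightEnd s := by
  rw [rightEnd, leftEnd_concat_true, width_concat, rightEnd]
  ring

/-- The average of `f` over the dyadic interval of the numbers whose binary expansion begins with
`s`. -/
noncomputable def average (f : ℝ → ℝ) (s : List Bool) : ℝ :=
  (∫ x in leftEnd s..rightEnd s, f x) / width s

theorem average_eq_add_div_two {f : ℝ → ℝ} (hf : Continuous f) (s : List Bool) :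
    average f s = (average f (s ++ [false]) + average f (s ++ [true])) / 2 := by
  have hw := (width_pos s).ne'
  rw [average, ← intervalIntegral.integral_add_adjacent_intervals
    (hf.intervalIntegrable _ (leftEnd s + width s / 2)) (hf.intervalIntegrable _ _), average,
    average, width_concat, width_concat, leftEnd_concat_false, rightEnd_concat_false,
    leftEnd_concat_true, rightEnd_concat_true]
  field_simp

theorem average_const (a : ℝ) (s : List Bool) : average (fun _ => a) s = a := by
  have := (width_pos s).ne'
  simp [average, rightEnd, this]

theorem average_add_div_two {f g : ℝ → ℝ} (hf : Continuous f) (hg : Continuous g) (s : List Bool) :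
    average (fun x => (f x + g x) / 2) s = (average f s + average g s) / 2 := by
  rw [average, intervalIntegral.integral_div, intervalIntegral.integral_add
    (hf.intervalIntegrable _ _) (hg.intervalIntegrable _ _), average, average]
  ring

theorem average_mono {f g : ℝ → ℝ} (hf : Continuous f) (hg : Continuous g) {s : List Bool}
    (h : ∀ x ∈ Set.Icc (leftEnd s) (rightEnd s), f x ≤ g x) : average f s ≤ average g s :=
  div_le_div_of_nonneg_right (intervalIntegral.integral_mono_on (leftEnd_lt_rightEnd s).le
    (hf.intervalIntegrable _ _) (hg.intervalIntegrable _ _) h) (width_pos s).le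

theorem average_mem_Icc {f : ℝ → ℝ} (hf : Continuous f) {s : List Bool}
    (h : ∀ x ∈ Set.Icc (leftEnd s) (rightEnd s), f x ∈ Set.Icc 0 1) :
    average f s ∈ Set.Icc 0 1 :=
  ⟨(average_const 0 s).symm.trans_le (average_mono continuous_const hf fun x hx => (h x hx).1),
    (average_mono hf continuous_const fun x hx => (h x hx).2).trans_eq (average_const 1 s)⟩

/-! ### The success probability of a trial -/

/-- The probabilities that a trial succeeds in the states of a von Neumann machine, characterized by
conditioning on the next flip: `compare m u v` in the states `TrialState.compare N m u v`, and
`entry m s` when `m` entries are to be drawn and the number with known bits `s` is stored. -/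
structure SuccessProbability (r : Rule) where
  entry : ℕ → List Bool → ℝ
  compare : ℕ → List Bool → List Bool → ℝ
  entry_zero : ∀ s, entry 0 s = 1
  entry_succ : ∀ m s, entry (m + 1) s = compare m [] s
  compare_mem_Icc : ∀ m u v, compare m u v ∈ Set.Icc 0 1
  compare_nil : ∀ m u, compare m u [] = (compare m u [false] + compare m u [true]) / 2
  compare_cons : ∀ m u a v, compare m u (a :: v) = (compare m (u ++ [a]) v +
    if a = r.passBit then 0 else entry m (r.store (u ++ a :: v) (u ++ [!a]))) / 2

/-- The probability that `m` uniform variables are sorted and all larger than `x`. -/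
noncomputable def sortedTail (m : ℕ) (x : ℝ) : ℝ := (1 - x) ^ m / m.factorial

theorem continuous_sortedTail (m : ℕ) : Continuous (sortedTail m) := by
  unfold sortedTail
  fun_prop

theorem integral_sortedTail (m : ℕ) (a b : ℝ) :
    ∫ x in a..b, sortedTail m x = sortedTail (m + 1) a - sortedTail (m + 1) b := by
  simp only [sortedTail, intervalIntegral.integral_div,
    intervalIntegral.integral_comp_sub_left (fun x : ℝ => x ^ m), integral_pow, Nat.factorial_succ,
    Nat.cast_mul, Nat.cast_add, Nat.cast_one]
  field_simp

theorem sortedTail_mem_Icc (m : ℕ) {x : ℝ} (h0 : 0 ≤ x) (h1 : x ≤ 1) :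
    sortedTail m x ∈ Set.Icc 0 1 := by
  have hpow : (1 - x) ^ m ≤ 1 := pow_le_one₀ (sub_nonneg.2 h1) (sub_le_self 1 h0)
  refine ⟨div_nonneg (pow_nonneg (sub_nonneg.2 h1) m) (Nat.cast_nonneg _), ?_⟩
  exact div_le_one_of_le₀ (hpow.trans (mod_cast m.factorial_pos)) (Nat.cast_nonneg _)

/-- The probability that a uniform variable with leading bits `u` is larger than `x`, followed by
`m` sorted variables larger than it. -/
noncomputable def sortedPass (m : ℕ) (u : List Bool) (x : ℝ) : ℝ :=
  (sortedTail (m + 1) x - sortedTail (m + 1) (rightEnd u)) / width u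

theorem continuous_sortedPass (m : ℕ) (u : List Bool) : Continuous (sortedPass m u) :=
  ((continuous_sortedTail _).sub continuous_const).div_const _

theorem sortedPass_mem_Icc (m : ℕ) {u : List Bool} {x : ℝ}
    (hx : x ∈ Set.Icc (leftEnd u) (rightEnd u)) : sortedPass m u x ∈ Set.Icc 0 1 := by
  have hy : ∀ y ∈ Set.Icc x (rightEnd u), sortedTail m y ∈ Set.Icc 0 1 := fun y hy =>
    sortedTail_mem_Icc m ((leftEnd_nonneg u).trans (hx.1.trans hy.1))
      (hy.2.trans (rightEnd_le_one u))
  rw [sortedPass, ← integral_sortedTail]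
  refine ⟨div_nonneg (intervalIntegral.integral_nonneg hx.2 fun y h => (hy y h).1)
    (width_pos u).le, (div_le_one (width_pos u)).2 ?_⟩
  calc ∫ y in x..rightEnd u, sortedTail m y ≤ ∫ _ in x..rightEnd u, (1 : ℝ) :=
        intervalIntegral.integral_mono_on hx.2 ((continuous_sortedTail m).intervalIntegrable _ _)
          (continuous_const.intervalIntegrable _ _) fun y h => (hy y h).2
    _ ≤ width u := by
        rw [integral_one, sub_le_comm]
        exact (add_sub_cancel_right _ _).trans_le hx.1

theorem sortedPass_nil (m : ℕ) : sortedPass m [] = sortedTail (m + 1) := by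
  funext x
  simp [sortedPass, rightEnd, leftEnd, width, sortedTail]

theorem sortedPass_eq_true (m : ℕ) (u : List Bool) (x : ℝ) :
    sortedPass m u x = (sortedPass m (u ++ [true]) x + 0) / 2 := by
  have hw := (width_pos u).ne'
  rw [sortedPass, sortedPass, rightEnd_concat_true, width_concat]
  field_simp
  ring

theorem sortedPass_eq_false (m : ℕ) (u : List Bool) (x : ℝ) :
    sortedPass m u x =
      (sortedPass m (u ++ [false]) x + average (sortedTail m) (u ++ [true])) / 2 := by
  have hw := (width_pos u).ne'
  rw [sortedPass, sortedPass, average, integral_sortedTail, rightEnd_concat_false,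
    leftEnd_concat_true, rightEnd_concat_true, width_concat, width_concat]
  field_simp
  ring

/-- The success probabilities of the machine of the sorted permutations. -/
noncomputable def sortedSuccess : SuccessProbability sortedRule where
  entry m := average (sortedTail m)
  compare m u v := average (sortedPass m u) (u ++ v)
  entry_zero s := by
    have hone : sortedTail 0 = fun _ => 1 := by
      funext x
      simp [sortedTail]
    rw [hone, average_const]
  entry_succ m s := by rw [sortedPass_nil, List.nil_append]
  compare_mem_Icc m u v := average_mem_Icc (continuous_sortedPass m u) fun x hx =>
    sortedPass_mem_Icc m (Icc_append_subset u v hx)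
  compare_nil m u := by
    rw [List.append_nil, average_eq_add_div_two (continuous_sortedPass m u)]
  compare_cons m u a v := by
    rw [List.append_cons u a v]
    cases a
    · rw [funext (sortedPass_eq_false m u),
        average_add_div_two (continuous_sortedPass m _) continuous_const, average_const]
      rfl
    · rw [funext (sortedPass_eq_true m u),
        average_add_div_two (continuous_sortedPass m _) continuous_const, average_const]
      rfl

/-- The probability that a uniform variable with leading bits `u` and `m` further uniform variables
are all smaller than `x`. -/
noncomputable def smallerPass (m : ℕ) (u : List Bool) (x : ℝ) : ℝ :=
  x ^ m * (x - leftEnd u) / width u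

theorem continuous_smallerPass (m : ℕ) (u : List Bool) : Continuous (smallerPass m u) := by
  unfold smallerPass
  fun_prop

theorem smallerPass_mem_Icc (m : ℕ) {u : List Bool} {x : ℝ}
    (hx : x ∈ Set.Icc (leftEnd u) (rightEnd u)) : smallerPass m u x ∈ Set.Icc 0 1 := by
  have hx0 : 0 ≤ x := (leftEnd_nonneg u).trans hx.1
  have hpow : x ^ m ≤ 1 := pow_le_one₀ hx0 (hx.2.trans (rightEnd_le_one u))
  have hle : x - leftEnd u ≤ width u := sub_le_iff_le_add'.2 hx.2
  refine ⟨div_nonneg (mul_nonneg (pow_nonneg hx0 m) (sub_nonneg.2 hx.1)) (width_pos u).le,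
    (div_le_one (width_pos u)).2 ?_⟩
  exact (mul_le_of_le_one_left (sub_nonneg.2 hx.1) hpow).trans hle

theorem smallerPass_nil (m : ℕ) : smallerPass m [] = fun x => x ^ (m + 1) := by
  funext x
  simp [smallerPass, leftEnd, width, pow_succ]

theorem smallerPass_eq_false (m : ℕ) (u : List Bool) (x : ℝ) :
    smallerPass m u x = (smallerPass m (u ++ [false]) x + 0) / 2 := by
  have hw := (width_pos u).ne'
  rw [smallerPass, smallerPass, leftEnd_concat_false, width_concat]
  field_simp
  ring

theorem smallerPass_eq_true (m : ℕ) (u : List Bool) (x : ℝ) :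
    smallerPass m u x = (smallerPass m (u ++ [true]) x + x ^ m) / 2 := by
  have hw := (width_pos u).ne'
  rw [smallerPass, smallerPass, leftEnd_concat_true, width_concat]
  field_simp
  ring

/-- The success probabilities of the machine of the permutations whose first element is the
largest. -/
noncomputable def firstLargestSuccess : SuccessProbability firstLargestRule where
  entry m := average (fun x => x ^ m)
  compare m u v := average (smallerPass m u) (u ++ v)
  entry_zero s := by simpa only [pow_zero] using average_const 1 s
  entry_succ m s := by rw [smallerPass_nil, List.nil_append]
  compare_mem_Icc m u v := average_mem_Icc (continuous_smallerPass m u) fun x hx =>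
    smallerPass_mem_Icc m (Icc_append_subset u v hx)
  compare_nil m u := by
    rw [List.append_nil, average_eq_add_div_two (continuous_smallerPass m u)]
  compare_cons m u a v := by
    rw [List.append_cons u a v]
    cases a
    · rw [funext (smallerPass_eq_false m u),
        average_add_div_two (continuous_smallerPass m _) continuous_const, average_const]
      rfl
    · rw [funext (smallerPass_eq_true m u),
        average_add_div_two (continuous_smallerPass m _) (continuous_pow m)]
      rfl

namespace SuccessProbability

variable {r : Rule} (P : SuccessProbability r)

/-- The probability that a trial of a given size succeeds. -/
def trial : ℕ → ℝ
  | 0 => if r.acceptsEmpty then 1 else 0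
  | n + 1 => P.entry n []

theorem trial_mem_Icc (n : ℕ) : P.trial n ∈ Set.Icc 0 1 := by
  match n with
  | 0 =>
    rw [trial]
    split_ifs <;> simp
  | 1 => simp [trial, P.entry_zero]
  | n + 2 =>
    rw [trial, P.entry_succ]
    exact P.compare_mem_Icc n [] []

/-- The probability of an event, in a snapshot of the flowchart: the indicator of a set `E` at the
end, and `D N c` after `N` successes and `c` calls. -/
noncomputable def value (E : Set (ℕ × ℕ)) (D : ℕ → ℕ → ℝ) : Snapshot TrialState → ℝ
  | ⟨.draw N, _, c⟩ => D N c
  | ⟨.compare N m u v, _, c⟩ =>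
      P.compare m u v * E.indicator 1 (N, c) + (1 - P.compare m u v) * D 0 c
  | ⟨.accept N, _, c⟩ => E.indicator 1 (N, c)

variable {E : Set (ℕ × ℕ)} {D : ℕ → ℕ → ℝ}

theorem value_entry (N m : ℕ) (s : List Bool) (f c : ℕ) :
    P.value E D ⟨.entry N m s, f, c⟩ =
      P.entry m s * E.indicator 1 (N, c) + (1 - P.entry m s) * D 0 c := by
  cases m
  · simp [TrialState.entry, value, P.entry_zero]
  · rw [P.entry_succ]
    rfl

theorem value_afterDraw (N f c : ℕ) :
    P.value E D ⟨r.afterDraw N, f, c⟩ =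
      P.trial N * E.indicator 1 (N, c) + (1 - P.trial N) * D 0 c := by
  cases N
  · rw [Rule.afterDraw, trial]
    split_ifs <;> simp [value]
  · exact P.value_entry _ _ _ _ _

theorem value_mem_Icc (hD : ∀ N c, D N c ∈ Set.Icc 0 1) (k : Snapshot TrialState) :
    P.value E D k ∈ Set.Icc 0 1 := by
  have hE (e : ℕ × ℕ) : E.indicator (1 : ℕ × ℕ → ℝ) e ∈ Set.Icc 0 1 :=
    ⟨Set.indicator_nonneg (fun _ _ => zero_le_one) e,
      Set.indicator_le_self' (fun _ _ => zero_le_one) e⟩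
  rcases k with ⟨N | ⟨N, m, u, v⟩ | N, f, c⟩
  · exact hD N c
  · exact convex_Icc 0 1 (hE _) (hD 0 c) (P.compare_mem_Icc m u v).1
      (sub_nonneg.2 (P.compare_mem_Icc m u v).2) (add_sub_cancel _ _)
  · exact hE _

theorem mean_value {q : ℕ → unitInterval}
    (hrec : ∀ N c, D N c = q c * D (N + 1) (c + 1) + (1 - q c) *
      (P.trial N * E.indicator 1 (N, c + 1) + (1 - P.trial N) * D 0 (c + 1)))
    (k : Snapshot TrialState) : r.flowchart.mean q (P.value E D) k = P.value E D k := by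
  rcases k with ⟨N | ⟨N, m, u, _ | ⟨a, v⟩⟩ | N, f, c⟩
  · have hafter := P.value_afterDraw (E := E) (D := D) N f (c + 1)
    simp only [Flowchart.mean, Rule.flowchart, if_true, Bool.false_eq_true, if_false, hafter]
    exact (hrec N c).symm
  · simp only [Flowchart.mean, Rule.flowchart, value, P.compare_nil m u]
    ring
  · have hafter : P.value E D ⟨r.afterCompare N m u a v, f + 1, c⟩ =
        (if a = r.passBit then 0 else P.entry m (r.store (u ++ a :: v) (u ++ [!a]))) *
            E.indicator 1 (N, c) +
          (1 - if a = r.passBit then 0 else P.entry m (r.store (u ++ a :: v) (u ++ [!a]))) *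
            D 0 c := by
      rw [Rule.afterCompare]
      split_ifs
      · simp [value]
      · exact P.value_entry _ _ _ _ _
    have hcompare : P.value E D ⟨.compare N m u (a :: v), f, c⟩ =
        (P.value E D ⟨.compare N m (u ++ [a]) v, f + 1, c⟩ +
          P.value E D ⟨r.afterCompare N m u a v, f + 1, c⟩) / 2 := by
      rw [hafter]
      simp only [value, P.compare_cons m u a v]
      ring
    rw [hcompare]
    cases a <;> simp [Flowchart.mean, Rule.flowchart, add_comm]
  · rfl

theorem measureReal_haltingEvent_eq {q : ℕ → unitInterval}
    (hD : ∀ N c, D N c ∈ Set.Icc 0 1)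
    (hrec : ∀ N c, D N c = q c * D (N + 1) (c + 1) + (1 - q c) *
      (P.trial N * E.indicator 1 (N, c + 1) + (1 - P.trial N) * D 0 (c + 1)))
    (hae : ∀ᵐ ω ∂variableSource q, ω ∈ r.flowchart.haltingEvent .univ ⟨.draw 0, 0, 0⟩) :
    (variableSource q).real (r.flowchart.haltingEvent E ⟨.draw 0, 0, 0⟩) = D 0 0 := by
  refine Flowchart.measureReal_haltingEvent_eq (Φ := P.value E D) (P.value_mem_Icc hD) ?_ ?_
    (P.mean_value hrec) hae
  all_goals
    rintro ⟨_, f, c⟩ hk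
    obtain ⟨N, rfl, hN⟩ := Rule.mem_haltedIn_flowchart.1 hk
  · exact Set.indicator_of_mem hN _
  · exact Set.indicator_of_notMem hN _

end SuccessProbability

theorem sortedSuccess_trial (n : ℕ) : sortedSuccess.trial n = (n.factorial : ℝ)⁻¹ := by
  cases n with
  | zero => simp [SuccessProbability.trial, sortedRule]
  | succ n =>
    simp only [SuccessProbability.trial, sortedSuccess, average, integral_sortedTail]
    simp [leftEnd, rightEnd, width, sortedTail]

theorem firstLargestSuccess_trial (n : ℕ) : firstLargestSuccess.trial n = (n : ℝ)⁻¹ := by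
  cases n with
  | zero => simp [SuccessProbability.trial, firstLargestRule]
  | succ n =>
    simp [SuccessProbability.trial, firstLargestSuccess, average, leftEnd, rightEnd, width,
      integral_pow]

/-! ### The law of the output -/

/-- The expected value of `w` at a geometric variable of parameter `x`. -/
noncomputable def geometricMean (x : ℝ) (w : ℕ → ℝ) : ℝ := (1 - x) * ∑' i, w i * x ^ i

section GeometricMean

variable {x : ℝ} {w : ℕ → ℝ}

theorem summable_mul_geometric (h0 : 0 ≤ x) (h1 : x < 1) (hw : ∀ i, w i ∈ Set.Icc 0 1) :
    Summable fun i => w i * x ^ i :=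
  (summable_geometric_of_lt_one h0 h1).of_nonneg_of_le
    (fun i => mul_nonneg (hw i).1 (pow_nonneg h0 i))
    fun i => mul_le_of_le_one_left (pow_nonneg h0 i) (hw i).2

theorem geometricMean_mem_Icc (h0 : 0 ≤ x) (h1 : x < 1) (hw : ∀ i, w i ∈ Set.Icc 0 1) :
    geometricMean x w ∈ Set.Icc 0 1 := by
  have h1' := sub_pos.2 h1
  refine ⟨mul_nonneg h1'.le (tsum_nonneg fun i => mul_nonneg (hw i).1 (pow_nonneg h0 i)), ?_⟩
  calc geometricMean x w ≤ (1 - x) * ∑' i, x ^ i :=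
        mul_le_mul_of_nonneg_left ((summable_mul_geometric h0 h1 hw).tsum_le_tsum
          (fun i => mul_le_of_le_one_left (pow_nonneg h0 i) (hw i).2)
          (summable_geometric_of_lt_one h0 h1)) h1'.le
    _ = 1 := by rw [tsum_geometric_of_lt_one h0 h1, mul_inv_cancel₀ h1'.ne']

theorem geometricMean_eq (h0 : 0 ≤ x) (h1 : x < 1) (hw : ∀ i, w i ∈ Set.Icc 0 1) :
    geometricMean x w = x * geometricMean x (fun i => w (i + 1)) + (1 - x) * w 0 := by
  rw [geometricMean, (summable_mul_geometric h0 h1 hw).tsum_eq_zero_add, geometricMean]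
  simp only [pow_succ, ← mul_assoc, tsum_mul_right, pow_zero, mul_one]
  ring

/-- The fixed-point equation of a scheme that succeeds in size `i` with probability `e i` and is
worth `L` after a failure: it is worth the share of size `n` among the successes. -/
theorem geometricMean_restart (h0 : 0 ≤ x) (h1 : x < 1) {e : ℕ → ℝ} {G L : ℝ}
    (hG : HasSum (fun i => e i * x ^ i) G) {n : ℕ} (hL : L * G = e n * x ^ n) :
    geometricMean x (fun i => e i * (if i = n then 1 else 0) + (1 - e i) * L) = L := by
  have hsum : HasSum (fun i => (e i * (if i = n then 1 else 0) + (1 - e i) * L) * x ^ i)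
      (e n * x ^ n + ((1 - x)⁻¹ - G) * L) := by
    convert (hasSum_ite_eq n (e n * x ^ n)).add
      (((hasSum_geometric_of_lt_one h0 h1).sub hG).mul_right L) using 2 with i
    split_ifs with hi
    · rw [hi]
      ring
    · ring
  have hne : 1 - x ≠ 0 := (sub_pos.2 h1).ne'
  rw [geometricMean, hsum.tsum_eq, ← hL]
  field_simp
  ring

end GeometricMean

theorem SuccessProbability.measureReal_haltingEvent_fst {r : Rule} (P : SuccessProbability r)
    {lam : unitInterval} (h0 : 0 < lam) (h1 : lam < 1) {G : ℝ} (hG0 : 0 < G)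
    (hG : HasSum (fun i => P.trial i * (lam : ℝ) ^ i) G) (n : ℕ) :
    (source lam).real (r.flowchart.haltingEvent {e | e.1 = n} ⟨.draw 0, 0, 0⟩) =
      P.trial n * lam ^ n / G := by
  set L := P.trial n * (lam : ℝ) ^ n / G
  have hlam : (0 : ℝ) ≤ lam := lam.2.1
  have hnonneg (i : ℕ) : 0 ≤ P.trial i * (lam : ℝ) ^ i :=
    mul_nonneg (P.trial_mem_Icc i).1 (pow_nonneg hlam i)
  have hL01 : L ∈ Set.Icc 0 1 := ⟨div_nonneg (hnonneg n) hG0.le,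
    (div_le_one hG0).2 (le_hasSum hG n fun i _ => hnonneg i)⟩
  let w (N : ℕ) : ℝ := P.trial N * (if N = n then 1 else 0) + (1 - P.trial N) * L
  have hw (N : ℕ) : w N ∈ Set.Icc 0 1 := by
    refine convex_Icc 0 1 ?_ hL01 (P.trial_mem_Icc N).1 (sub_nonneg.2 (P.trial_mem_Icc N).2)
      (add_sub_cancel _ _)
    split_ifs <;> simp
  have hrestart : geometricMean lam (fun i => w (i + 0)) = L :=
    geometricMean_restart hlam h1 hG (div_mul_cancel₀ _ hG0.ne')
  rw [source_eq_variableSource, ← hrestart]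
  refine P.measureReal_haltingEvent_eq (D := fun N _ => geometricMean lam fun i => w (i + N))
    (fun N _ => geometricMean_mem_Icc hlam h1 fun i => hw (i + N)) (fun N c => ?_)
    (r.hasExponentialTail h0 h1 _).ae_mem_haltingEvent
  have hind : Set.indicator {e : ℕ × ℕ | e.1 = n} (1 : ℕ × ℕ → ℝ) (N, c + 1) =
      if N = n then 1 else 0 := by simp [Set.indicator_apply]
  rw [hrestart, hind, geometricMean_eq hlam h1 fun i => hw (i + N), zero_add]
  simp only [w, add_assoc, add_comm 1]

/-! ### The exponential generating functions of the two classes -/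

theorem egfCoeff_sortedClass : egfCoeff sortedClass = fun n => (n.factorial : ℝ)⁻¹ := by
  funext n
  have h : sortedClass n = {1} := Set.ext fun σ => Equiv.Perm.monotone_iff σ
  simp [egfCoeff, h]

theorem hasSum_sortedClass (z : ℝ) :
    HasSum (fun n => egfCoeff sortedClass n * z ^ n) (Real.exp z) := by
  have h := NormedSpace.expSeries_div_hasSum_exp z
  rw [← Real.exp_eq_exp_ℝ] at h
  simpa only [egfCoeff_sortedClass, div_eq_inv_mul] using h

theorem firstLargestClass_zero : firstLargestClass 0 = ∅ := by
  ext σ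
  simp [firstLargestClass]

theorem mem_firstLargestClass_succ {m : ℕ} {σ : Equiv.Perm (Fin (m + 1))} :
    σ ∈ firstLargestClass (m + 1) ↔ σ 0 = Fin.last m := by
  constructor
  · rintro ⟨_, h⟩
    have hlast := h (σ.symm (Fin.last m))
    rw [Equiv.apply_symm_apply] at hlast
    exact Fin.last_le_iff.1 hlast
  · intro h
    exact ⟨m.succ_pos, fun i => (Fin.le_last _).trans_eq h.symm⟩

theorem ncard_firstLargestClass_succ (m : ℕ) :
    (firstLargestClass (m + 1)).ncard = m.factorial := by
  have h : firstLargestClass (m + 1) =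
      Equiv.Perm.decomposeFin.symm '' (({Fin.last m} : Set (Fin (m + 1))) ×ˢ Set.univ) := by
    ext σ
    obtain ⟨⟨a, τ⟩, rfl⟩ := Equiv.Perm.decomposeFin.symm.surjective σ
    simp [mem_firstLargestClass_succ, Equiv.Perm.decomposeFin_symm_apply_zero]
  rw [h, Set.ncard_image_of_injective _ (Equiv.injective _), Set.ncard_prod, Set.ncard_singleton,
    one_mul, Set.ncard_univ, Nat.card_eq_fintype_card, Fintype.card_perm, Fintype.card_fin]

theorem egfCoeff_firstLargestClass : egfCoeff firstLargestClass = fun n : ℕ => (n : ℝ)⁻¹ := by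
  funext n
  cases n with
  | zero => simp [egfCoeff, firstLargestClass_zero]
  | succ m =>
    have := m.factorial_ne_zero
    rw [egfCoeff, ncard_firstLargestClass_succ, Nat.factorial_succ]
    push_cast
    field_simp

theorem hasSum_firstLargestClass {z : ℝ} (hz : |z| < 1) :
    HasSum (fun n => egfCoeff firstLargestClass n * z ^ n) (Real.log (1 - z)⁻¹) := by
  have h := Real.hasSum_pow_div_log_of_abs_lt_one hz
  rw [← Real.log_inv] at h
  rw [egfCoeff_firstLargestClass, ← hasSum_nat_add_iff' 1]
  simpa [div_eq_inv_mul] using h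

/-! ### The order type of independent uniform variables -/

theorem orderType_eq_iff {n : ℕ} {α : Type*} [LinearOrder α] {u : Fin n → α}
    {σ : Equiv.Perm (Fin n)} :
    orderType u = σ ↔ Monotone (u ∘ ⇑σ⁻¹) ∧
      ∀ i j, i < j → u (σ⁻¹ i) = u (σ⁻¹ j) → σ⁻¹ i < σ⁻¹ j := by
  rw [orderType, inv_eq_iff_eq_inv, eq_comm, Tuple.eq_sort_iff]

theorem orderType_comp_perm {n : ℕ} {α : Type*} [LinearOrder α] {u : Fin n → α}
    (hu : Function.Injective u) (τ : Equiv.Perm (Fin n)) :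
    orderType (u ∘ τ) = orderType u * τ := by
  have hsort : (u ∘ τ) ∘ ⇑(orderType u * τ)⁻¹ = u ∘ Tuple.sort u := by
    ext i
    simp [orderType]
  refine orderType_eq_iff.2 ⟨hsort ▸ Tuple.monotone_sort u, fun i j hij h => ?_⟩
  exact absurd ((hu.comp τ.injective).comp (Equiv.injective _) h) hij.ne

theorem measurableSet_orderType_eq {n : ℕ} (σ : Equiv.Perm (Fin n)) :
    MeasurableSet {u : Fin n → unitInterval | orderType u = σ} := by
  have hle (i j : Fin n) : Measurable fun u : Fin n → unitInterval => u (σ⁻¹ i) ≤ u (σ⁻¹ j) :=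
    measurableSet_setOfPred.1 (measurableSet_le (measurable_pi_apply _) (measurable_pi_apply _))
  have heq (i j : Fin n) : Measurable fun u : Fin n → unitInterval => u (σ⁻¹ i) = u (σ⁻¹ j) :=
    measurableSet_setOfPred.1
      (measurableSet_eq_fun (measurable_pi_apply _) (measurable_pi_apply _))
  simp only [orderType_eq_iff]
  refine measurableSet_setOfPred.2 (.and ?_ ?_)
  · exact .forall fun i => .forall fun j => .imp measurable_const (hle i j)
  · exact .forall fun i => .forall fun j =>
      .imp measurable_const (.imp (heq i j) measurable_const)

theorem measurableSet_orderType_mem {n : ℕ} (S : Set (Equiv.Perm (Fin n))) :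
    MeasurableSet {u : Fin n → unitInterval | orderType u ∈ S} := by
  have h : {u : Fin n → unitInterval | orderType u ∈ S} = ⋃ σ ∈ S, {u | orderType u = σ} := by
    ext
    simp
  rw [h]
  exact .biUnion S.to_countable fun σ _ => measurableSet_orderType_eq σ

/-- The law of independent uniform variables on `[0, 1]`, indexed by `ι`. -/
noncomputable abbrev uniformProduct (ι : Type*) : Measure (ι → unitInterval) :=
  Measure.infinitePi fun _ => volume

theorem measurePreserving_comp_uniformProduct {ι κ : Type*} {f : κ → ι}
    (hf : Function.Injective f) :
    MeasurePreserving (fun u : ι → unitInterval => u ∘ f) (uniformProduct ι) (uniformProduct κ) :=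
  ⟨measurable_pi_lambda _ fun _ => measurable_pi_apply _,
    Measure.map_infinitePi_infinitePi_of_inj (P := fun _ => volume) hf⟩

theorem uniformProduct_apply_eq_apply {ι : Type*} {i j : ι} (hij : i ≠ j) :
    uniformProduct ι {u | u i = u j} = 0 := by
  let diagonal : Set (unitInterval × unitInterval) := {z | z.1 = z.2}
  have hdiagonal : MeasurableSet diagonal := measurableSet_eq_fun measurable_fst measurable_snd
  have hpair : uniformProduct ι {u | u i = u j} =
      ((volume : Measure unitInterval).prod volume) diagonal := by
    rw [← Measure.infinitePi_map_eval_prod (P := fun _ : ι => (volume : Measure unitInterval)) hij,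
      Measure.map_apply (by fun_prop) hdiagonal]
    rfl
  rw [hpair, Measure.measure_prod_null hdiagonal]
  filter_upwards with a
  have hslice : Prod.mk a ⁻¹' diagonal = {a} := by
    ext
    simp [diagonal, eq_comm]
  rw [hslice, measure_singleton]
  rfl

theorem ae_injective_uniformProduct (ι : Type*) [Countable ι] :
    ∀ᵐ u ∂uniformProduct ι, Function.Injective u := by
  have h : ∀ᵐ u ∂uniformProduct ι, ∀ i j, i ≠ j → u i ≠ u j := by
    simp only [ae_all_iff]
    intro i j hij
    simpa [ae_iff] using uniformProduct_apply_eq_apply hij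
  filter_upwards [h] with u hu i j
  exact not_imp_not.1 (hu i j)

theorem uniformProduct_orderType_eq {n : ℕ} (σ : Equiv.Perm (Fin n)) :
    uniformProduct (Fin n) {u | orderType u = σ} = (n.factorial : ENNReal)⁻¹ := by
  have hsymm (σ : Equiv.Perm (Fin n)) : uniformProduct (Fin n) {u | orderType u = σ} =
      uniformProduct (Fin n) {u | orderType u = 1} := by
    rw [← (measurePreserving_comp_uniformProduct σ.injective).measure_preimage
      (measurableSet_orderType_eq σ).nullMeasurableSet]
    refine measure_congr (Filter.eventuallyEq_set.2 ?_)
    filter_upwards [ae_injective_uniformProduct (Fin n)] with u hu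
    simp only [Set.mem_preimage, Set.mem_ofPred_eq, orderType_comp_perm hu, mul_eq_right]
  have hsum : ∑ σ : Equiv.Perm (Fin n), uniformProduct (Fin n) {u | orderType u = σ} = 1 := by
    have h := sum_measure_preimage_singleton (μ := uniformProduct (Fin n)) Finset.univ
      (f := fun u : Fin n → unitInterval => orderType u) fun σ _ => measurableSet_orderType_eq σ
    rwa [Finset.coe_univ, Set.preimage_univ, measure_univ] at h
  simp_rw [hsymm] at hsum ⊢
  rw [Finset.sum_const, Finset.card_univ, Fintype.card_perm, Fintype.card_fin, nsmul_eq_mul] at hsum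
  exact ENNReal.eq_inv_of_mul_eq_one_left (by rwa [mul_comm] at hsum)

theorem uniformProduct_orderType_mem (P : PermClass) (n : ℕ) :
    uniformProduct (Fin n) {u | orderType u ∈ P n} = ENNReal.ofReal (egfCoeff P n) := by
  calc
    uniformProduct (Fin n) {u | orderType u ∈ P n} =
        ∑ σ ∈ (P n).toFinite.toFinset, uniformProduct (Fin n) {u | orderType u = σ} := by
      have h := sum_measure_preimage_singleton (μ := uniformProduct (Fin n))
        (P n).toFinite.toFinset (f := fun u : Fin n → unitInterval => orderType u)
        fun σ _ => measurableSet_orderType_eq σ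
      rw [Set.Finite.coe_toFinset] at h
      exact h.symm
    _ = (P n).ncard * (n.factorial : ENNReal)⁻¹ := by
      simp_rw [uniformProduct_orderType_eq]
      rw [Finset.sum_const, ← Set.ncard_eq_toFinset_card, nsmul_eq_mul]
    _ = ENNReal.ofReal (egfCoeff P n) := by
      rw [egfCoeff, ENNReal.ofReal_div_of_pos (by positivity), ENNReal.ofReal_natCast,
        ENNReal.ofReal_natCast, div_eq_mul_inv]

theorem egfCoeff_mem_Icc (P : PermClass) (n : ℕ) : egfCoeff P n ∈ Set.Icc 0 1 := by
  have h : (P n).ncard ≤ n.factorial := by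
    simpa [Nat.card_eq_fintype_card, Fintype.card_perm] using Set.ncard_le_card (P n)
  refine ⟨div_nonneg (Nat.cast_nonneg _) (Nat.cast_nonneg _), ?_⟩
  rw [egfCoeff, div_le_one (by positivity)]
  exact_mod_cast h

/-! ### The von Neumann schema for given outcomes of the generator -/

section Schema

theorem geometric_spec {x : ℕ → Bool} {s : ℕ} (h : ∃ n, x (s + n) = false) :
    x (s + geometric x s) = false :=
  Nat.sInf_mem (s := {n | x (s + n) = false}) h

theorem eq_true_of_lt_geometric {x : ℕ → Bool} {s i : ℕ} (hi : i < geometric x s) :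
    x (s + i) = true :=
  Bool.not_eq_false _ ▸ Nat.notMem_of_lt_sInf hi

theorem lt_geometric_iff {x : ℕ → Bool} {s n : ℕ} :
    n < geometric x s ↔ (∀ i ≤ n, x (s + i) = true) ∧ ∃ m, x (s + m) = false := by
  constructor
  · intro hn
    have hne : {m | x (s + m) = false}.Nonempty := Nat.nonempty_of_pos_sInf (n.zero_le.trans_lt hn)
    exact ⟨fun i hi => eq_true_of_lt_geometric (hi.trans_lt hn), hne⟩
  · rintro ⟨htrue, hfalse⟩
    by_contra! hle
    exact Bool.false_ne_true ((geometric_spec hfalse).symm.trans (htrue _ hle))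

theorem consumed_strictMono (x : ℕ → Bool) : StrictMono (consumed x) :=
  strictMono_nat_of_lt_succ fun k => by
    simp only [consumed]
    omega

theorem measurable_geometric (s : ℕ) : Measurable fun x : ℕ → Bool => geometric x s := by
  have hx (i : ℕ) (b : Bool) : MeasurableSet {x : ℕ → Bool | x i = b} :=
    measurableSet_eq_fun (measurable_pi_apply i) measurable_const
  refine measurable_of_Ioi fun n => ?_
  have h : (fun x : ℕ → Bool => geometric x s) ⁻¹' Set.Ioi n =
      (⋂ i ≤ n, {x | x (s + i) = true}) ∩ ⋃ m, {x | x (s + m) = false} := by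
    ext x
    simp [lt_geometric_iff]
  rw [h]
  exact .inter (.iInter fun i => .iInter fun _ => hx _ _) (.iUnion fun m => hx _ _)

theorem measurable_geometric_comp {g : (ℕ → Bool) → ℕ} (hg : Measurable g) :
    Measurable fun x => geometric x (g x) := by
  have h : Measurable fun z : ℕ × (ℕ → Bool) => geometric z.2 z.1 :=
    measurable_from_prod_countable_right measurable_geometric
  exact h.comp (hg.prodMk measurable_id)

theorem measurable_consumed (k : ℕ) : Measurable fun x => consumed x k := by
  induction k with
  | zero => exact measurable_const
  | succ k ih => exact (ih.add (measurable_geometric_comp ih)).add measurable_const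

theorem measurable_trialSize (k : ℕ) : Measurable fun x => trialSize x k :=
  measurable_geometric_comp (measurable_consumed k)

/-- The sequences of entries with which a trial of size `N` succeeds. -/
def successSet (P : PermClass) (N : ℕ) : Set (ℕ → unitInterval) :=
  {v | orderType (fun j : Fin N => v j) ∈ P N}

variable (P : PermClass)

theorem measurableSet_successSet (N : ℕ) : MeasurableSet (successSet P N) :=
  (measurePreserving_comp_uniformProduct Fin.val_injective).measurable
    (measurableSet_orderType_mem (P N))

theorem uniformProduct_successSet (N : ℕ) :
    uniformProduct ℕ (successSet P N) = ENNReal.ofReal (egfCoeff P N) := by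
  rw [← uniformProduct_orderType_mem,
    ← (measurePreserving_comp_uniformProduct Fin.val_injective).measure_preimage
      (measurableSet_orderType_mem (P N)).nullMeasurableSet]
  rfl

theorem uniformProduct_successSet_compl (N : ℕ) :
    uniformProduct ℕ (successSet P N)ᶜ = ENNReal.ofReal (1 - egfCoeff P N) := by
  rw [prob_compl_eq_one_sub (measurableSet_successSet P N), uniformProduct_successSet,
    ENNReal.ofReal_sub _ (egfCoeff_mem_Icc P N).1, ENNReal.ofReal_one]

theorem measurableSet_trialSucceeds (k : ℕ) :
    MeasurableSet {η : (ℕ → Bool) × (ℕ × ℕ → unitInterval) | TrialSucceeds P η.1 η.2 k} := by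
  have h : {η : (ℕ → Bool) × (ℕ × ℕ → unitInterval) | TrialSucceeds P η.1 η.2 k} =
      ⋃ N, {η | trialSize η.1 k = N} ∩ {η | (fun j => η.2 (k, j)) ∈ successSet P N} := by
    ext η
    simp [TrialSucceeds, successSet]
  have hrow : Measurable fun (η : (ℕ → Bool) × (ℕ × ℕ → unitInterval)) j => η.2 (k, j) :=
    measurable_pi_lambda _ fun j => (measurable_pi_apply _).comp measurable_snd
  rw [h]
  exact .iUnion fun N => .inter
    (((measurable_trialSize k).comp measurable_fst) (measurableSet_singleton N))
    (hrow (measurableSet_successSet P N))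

theorem measurableSet_schemaReturns (n c : ℕ) :
    MeasurableSet {η : (ℕ → Bool) × (ℕ × ℕ → unitInterval) | SchemaReturns P η.1 η.2 n c} := by
  have hsucceeds (k) := measurableSet_setOfPred.1 (measurableSet_trialSucceeds P k)
  have hsize (k) : Measurable fun η : (ℕ → Bool) × (ℕ × ℕ → unitInterval) =>
      trialSize η.1 k = n :=
    measurableSet_setOfPred.1
      (((measurable_trialSize k).comp measurable_fst) (measurableSet_singleton n))
  have hconsumed (k) : Measurable fun η : (ℕ → Bool) × (ℕ × ℕ → unitInterval) =>
      consumed η.1 k = c :=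
    measurableSet_setOfPred.1
      (((measurable_consumed k).comp measurable_fst) (measurableSet_singleton c))
  exact measurableSet_setOfPred.2 (.exists fun k =>
    .and (.forall fun i => .imp measurable_const (hsucceeds i).not)
      (.and (hsucceeds k) (.and (hsize k) (hconsumed (k + 1)))))

theorem uniformProduct_forall_row_mem {ι κ : Type*} (s : Finset ι)
    {t : ι → Set (κ → unitInterval)} (ht : ∀ i, MeasurableSet (t i)) :
    uniformProduct (ι × κ) {U | ∀ i ∈ s, (fun j => U (i, j)) ∈ t i} =
      ∏ i ∈ s, uniformProduct κ (t i) := by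
  have hcurry := Measure.infinitePi_map_curry fun (_ : ι) (_ : κ) => (volume : Measure unitInterval)
  rw [← Measure.infinitePi_pi (μ := fun _ : ι => uniformProduct κ) fun i _ => ht i, ← hcurry,
    Measure.map_apply (MeasurableEquiv.measurable _)
      (.pi s.countable_toSet fun i _ => ht i)]
  rfl

theorem uniformProduct_first_success (x : ℕ → Bool) (k : ℕ) :
    uniformProduct (ℕ × ℕ) {U | (∀ i < k, ¬ TrialSucceeds P x U i) ∧ TrialSucceeds P x U k} =
      ENNReal.ofReal ((∏ i ∈ Finset.range k, (1 - egfCoeff P (trialSize x i))) *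
        egfCoeff P (trialSize x k)) := by
  let t (i : ℕ) : Set (ℕ → unitInterval) :=
    if i < k then (successSet P (trialSize x i))ᶜ else successSet P (trialSize x i)
  have ht (i : ℕ) : MeasurableSet (t i) := by
    have h := measurableSet_successSet P (trialSize x i)
    dsimp only [t]
    split_ifs
    exacts [h.compl, h]
  have hrow : {U | (∀ i < k, ¬ TrialSucceeds P x U i) ∧ TrialSucceeds P x U k} =
      {U : ℕ × ℕ → unitInterval | ∀ i ∈ Finset.range (k + 1), (fun j => U (i, j)) ∈ t i} := by
    ext U
    simp only [Set.mem_ofPred_eq, Finset.mem_range, Nat.lt_succ_iff_lt_or_eq, or_imp, forall_and,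
      forall_eq]
    refine and_congr (forall₂_congr fun i hi => ?_) ?_
    · simp only [t, if_pos hi]
      rfl
    · simp only [t, lt_irrefl, if_false]
      rfl
  rw [hrow, uniformProduct_forall_row_mem _ ht, Finset.prod_range_succ,
    ENNReal.ofReal_mul (Finset.prod_nonneg fun i _ => sub_nonneg.2 (egfCoeff_mem_Icc P _).2),
    ENNReal.ofReal_prod_of_nonneg fun i _ => sub_nonneg.2 (egfCoeff_mem_Icc P _).2]
  congr 1
  · refine Finset.prod_congr rfl fun i hi => ?_
    rw [← uniformProduct_successSet_compl]
    simp only [t, if_pos (Finset.mem_range.1 hi)]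
  · rw [← uniformProduct_successSet]
    simp only [t, lt_irrefl, if_false]

end Schema

section ReturnProbability

/-- The probability that the von Neumann schema stops with output `n` after `c₀` calls, given the
outcomes `x` of the generator, when a trial of size `i` succeeds with probability `e i` and `N`
successes have been counted in the current trial after `c` calls in all. -/
noncomputable def returnProbability (e : ℕ → ℝ) (x : ℕ → Bool) (n c₀ N c : ℕ) : ℝ :=
  if c < c₀ then
    if x c then returnProbability e x n c₀ (N + 1) (c + 1)
    else e N * Set.indicator {(n, c₀)} 1 (N, c + 1) +
      (1 - e N) * returnProbability e x n c₀ 0 (c + 1)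
  else 0
termination_by c₀ - c

variable {e : ℕ → ℝ} {x : ℕ → Bool} {n c₀ : ℕ}

theorem returnProbability_of_le {N c : ℕ} (h : c₀ ≤ c) : returnProbability e x n c₀ N c = 0 := by
  rw [returnProbability, if_neg h.not_gt]

theorem returnProbability_eq (N c : ℕ) :
    returnProbability e x n c₀ N c =
      if x c then returnProbability e x n c₀ (N + 1) (c + 1)
      else e N * Set.indicator {(n, c₀)} 1 (N, c + 1) +
        (1 - e N) * returnProbability e x n c₀ 0 (c + 1) := by
  rcases lt_or_ge c c₀ with h | h
  · rw [returnProbability, if_pos h]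
  · have hc : c + 1 ≠ c₀ := by omega
    simp [returnProbability_of_le h, returnProbability_of_le (h.trans c.le_succ), hc]

theorem returnProbability_mem_Icc (he : ∀ N, e N ∈ Set.Icc 0 1) (N c : ℕ) :
    returnProbability e x n c₀ N c ∈ Set.Icc 0 1 := by
  fun_induction returnProbability e x n c₀ N c with
  | case1 _ _ _ _ ih => exact ih
  | case2 N _ _ _ ih =>
    refine convex_Icc 0 1 ?_ ih (he N).1 (sub_nonneg.2 (he N).2) (add_sub_cancel _ _)
    rw [Set.indicator_apply]
    split_ifs <;> simp
  | case3 => simp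

theorem returnProbability_of_run {g c : ℕ} (N : ℕ) (htrue : ∀ i < g, x (c + i) = true)
    (hfalse : x (c + g) = false) :
    returnProbability e x n c₀ N c =
      e (N + g) * Set.indicator {(n, c₀)} 1 (N + g, c + g + 1) +
        (1 - e (N + g)) * returnProbability e x n c₀ 0 (c + g + 1) := by
  induction g generalizing N c with
  | zero => rw [returnProbability_eq, if_neg (by simpa using hfalse), add_zero, add_zero]
  | succ g ih =>
    have htrue' (i : ℕ) (hi : i < g) : x (c + 1 + i) = true := by
      rw [add_assoc, add_comm 1]
      exact htrue _ (Nat.succ_lt_succ hi)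
    rw [returnProbability_eq, if_pos (by exact htrue 0 g.succ_pos),
      ih (N + 1) htrue' (by rwa [add_assoc, add_comm 1])]
    simp only [add_assoc, add_comm 1]

theorem returnProbability_consumed (hx : ∀ s, ∃ i, x (s + i) = false) (k : ℕ) :
    returnProbability e x n c₀ 0 (consumed x k) =
      e (trialSize x k) * Set.indicator {(n, c₀)} 1 (trialSize x k, consumed x (k + 1)) +
        (1 - e (trialSize x k)) * returnProbability e x n c₀ 0 (consumed x (k + 1)) := by
  rw [returnProbability_of_run 0 (fun _ => eq_true_of_lt_geometric)
    (geometric_spec (hx (consumed x k))), zero_add]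
  rfl

theorem returnProbability_eq_prod_mul (hx : ∀ s, ∃ i, x (s + i) = false) {k : ℕ}
    (hk : ∀ i < k, (trialSize x i, consumed x (i + 1)) ≠ (n, c₀)) :
    returnProbability e x n c₀ 0 0 = (∏ i ∈ Finset.range k, (1 - e (trialSize x i))) *
      returnProbability e x n c₀ 0 (consumed x k) := by
  induction k with
  | zero => simp [consumed]
  | succ k ih =>
    rw [ih fun i hi => hk i (hi.trans k.lt_succ_self), returnProbability_consumed hx,
      Set.indicator_of_notMem (s := {(n, c₀)}) (hk k k.lt_succ_self), Finset.prod_range_succ]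
    ring

theorem uniformProduct_schemaReturns (P : PermClass) (hx : ∀ s, ∃ i, x (s + i) = false)
    (n c₀ : ℕ) :
    uniformProduct (ℕ × ℕ) {U | SchemaReturns P x U n c₀} =
      ENNReal.ofReal (returnProbability (egfCoeff P) x n c₀ 0 0) := by
  have hmono := consumed_strictMono x
  by_cases h : ∃ k, trialSize x k = n ∧ consumed x (k + 1) = c₀
  · obtain ⟨k, hk, hk'⟩ := h
    have hunique (i : ℕ) (hi : consumed x (i + 1) = c₀) : i = k :=
      Nat.succ_injective (hmono.injective (hi.trans hk'.symm))
    have hset : {U | SchemaReturns P x U n c₀} =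
        {U | (∀ i < k, ¬ TrialSucceeds P x U i) ∧ TrialSucceeds P x U k} := by
      ext U
      constructor
      · rintro ⟨i, hfail, hsucc, -, hi⟩
        obtain rfl := hunique i hi
        exact ⟨hfail, hsucc⟩
      · rintro ⟨hfail, hsucc⟩
        exact ⟨k, hfail, hsucc, hk, hk'⟩
    have hne (i : ℕ) (hi : i < k) : (trialSize x i, consumed x (i + 1)) ≠ (n, c₀) :=
      fun heq => hi.ne (hunique i (congrArg Prod.snd heq))
    rw [hset, uniformProduct_first_success, returnProbability_eq_prod_mul hx hne,
      returnProbability_consumed hx, returnProbability_of_le hk'.ge, hk, hk']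
    simp
  · have hset : {U | SchemaReturns P x U n c₀} = ∅ :=
      Set.eq_empty_of_forall_notMem fun U ⟨k, _, _, hk⟩ => h ⟨k, hk⟩
    rw [hset, measure_empty, returnProbability_eq_prod_mul hx (k := c₀) fun i _ heq =>
        h ⟨i, congrArg Prod.fst heq, congrArg Prod.snd heq⟩,
      returnProbability_of_le (show c₀ ≤ consumed x c₀ from hmono.id_le c₀), mul_zero,
      ENNReal.ofReal_zero]

end ReturnProbability

/-! ### Machines against the schema -/

instance (q : unitInterval) : IsProbabilityMeasure (bernoulliSequence q) := by
  unfold bernoulliSequence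
  infer_instance

theorem ae_exists_false {lam : unitInterval} (h1 : lam < 1) :
    ∀ᵐ x ∂bernoulliSequence lam, ∀ s, ∃ i, x (s + i) = false := by
  rw [ae_all_iff]
  intro s
  rw [ae_iff]
  have htrue : bernoulliMeasure true false lam {true} = ENNReal.ofReal lam := by
    rw [← bernoulliMeasure_real_singleton_true, ofReal_measureReal]
  have hle (n : ℕ) : bernoulliSequence lam {x | ¬ ∃ i, x (s + i) = false} ≤
      ENNReal.ofReal lam ^ n := by
    calc
      _ ≤ bernoulliSequence lam ((Finset.Ico s (s + n) : Set ℕ).pi fun _ => {true}) := by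
        refine measure_mono fun x hx i hi => ?_
        simp only [Set.mem_ofPred_eq, not_exists, Bool.not_eq_false] at hx
        obtain ⟨j, rfl⟩ := Nat.exists_eq_add_of_le (Finset.mem_Ico.1 hi).1
        exact hx j
      _ = _ := by
        rw [bernoulliSequence, Measure.infinitePi_pi _ fun _ _ => measurableSet_singleton _]
        simp [htrue]
  have hlim : Filter.Tendsto (fun n : ℕ => ENNReal.ofReal lam ^ n) .atTop (nhds 0) :=
    ENNReal.tendsto_pow_atTop_nhds_zero_of_lt_one (ENNReal.ofReal_lt_one.2 h1)
  exact le_antisymm (ge_of_tendsto' hlim hle) zero_le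

theorem variableSource_ite_apply (x : ℕ → Bool) {S : Set Source} (hS : MeasurableSet S) :
    variableSource (fun i => if x i then 1 else 0) S =
      bernoulliSequence half {a | (a, x) ∈ S} := by
  have hdirac : (bernoulliProduct fun i => if x i then 1 else 0) = Measure.dirac x := by
    rw [← Measure.infinitePi_dirac]
    congr! 2 with i
    cases hb : x i <;> simp [hb]
  rw [variableSource, hdirac, Measure.prod_dirac, Measure.map_apply (by fun_prop) hS]
  rfl

theorem SuccessProbability.bernoulliSequence_haltingEvent {r : Rule} (P : SuccessProbability r)
    {x : ℕ → Bool}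
    (hx : ∀ᵐ a ∂bernoulliSequence half, (a, x) ∈ r.flowchart.haltingEvent .univ ⟨.draw 0, 0, 0⟩)
    (n c₀ : ℕ) :
    bernoulliSequence half {a | (a, x) ∈ r.flowchart.haltingEvent {(n, c₀)} ⟨.draw 0, 0, 0⟩} =
      ENNReal.ofReal (returnProbability P.trial x n c₀ 0 0) := by
  have hmeas (E : Set (ℕ × ℕ)) :=
    Flowchart.measurableSet_haltingEvent (δ := r.flowchart) E ⟨.draw 0, 0, 0⟩
  have hhalt : ∀ᵐ ω ∂variableSource (fun i => if x i then 1 else 0),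
      ω ∈ r.flowchart.haltingEvent .univ ⟨.draw 0, 0, 0⟩ := by
    rw [ae_iff] at hx ⊢
    exact (variableSource_ite_apply x (hmeas _).compl).trans hx
  rw [← variableSource_ite_apply x (hmeas _), ← ofReal_measureReal,
    P.measureReal_haltingEvent_eq (D := returnProbability P.trial x n c₀)
      (returnProbability_mem_Icc P.trial_mem_Icc) (fun N c => ?_) hhalt]
  rw [returnProbability_eq]
  cases x c <;> simp

theorem Realizes.implementsSchema {p : Program} {r : Rule}
    {Rep : Snapshot TrialState → Config → Prop} (h : Realizes p r.flowchart (.draw 0) Rep)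
    (P : SuccessProbability r) {C : PermClass} (hP : P.trial = egfCoeff C) :
    ImplementsSchema p C := by
  intro lam h0 h1 A hA n c
  have hmeas (E : Set (ℕ × ℕ)) :=
    Flowchart.measurableSet_haltingEvent (δ := r.flowchart) E ⟨.draw 0, 0, 0⟩
  have hhalt := (r.hasExponentialTail h0 h1 ⟨.draw 0, 0, 0⟩).ae_mem_haltingEvent
  rw [← source_eq_variableSource] at hhalt
  have hmachine : source lam {ω | ω.input ∈ A ∧ ∃ f, HaltsWith p ω n f c} =
      source lam {ω | ω.input ∈ A ∧ ω ∈ r.flowchart.haltingEvent {(n, c)} ⟨.draw 0, 0, 0⟩} := by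
    refine measure_congr (Filter.eventuallyEq_set.2 ?_)
    filter_upwards [hhalt] with ω hω
    refine and_congr_right fun _ => ?_
    rw [← h.exists_haltsWith_iff hω]
    simp
  have hhalt' : ∀ᵐ x ∂bernoulliSequence lam, ∀ᵐ a ∂bernoulliSequence half,
      (a, x) ∈ r.flowchart.haltingEvent .univ ⟨.draw 0, 0, 0⟩ := by
    refine (Measure.ae_ae_comm ?_).1 (Measure.ae_ae_of_ae_prod hhalt)
    exact hmeas .univ
  have hmachine_meas : MeasurableSet {ω : Source | ω.input ∈ A ∧
      ω ∈ r.flowchart.haltingEvent {(n, c)} ⟨.draw 0, 0, 0⟩} :=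
    (measurable_snd hA).inter (hmeas _)
  have hschema_meas : MeasurableSet {η : (ℕ → Bool) × (ℕ × ℕ → unitInterval) |
      η.1 ∈ A ∧ SchemaReturns C η.1 η.2 n c} :=
    (measurable_fst hA).inter (measurableSet_schemaReturns C n c)
  rw [hmachine, source, schemaSource, Measure.prod_apply_symm hmachine_meas,
    Measure.prod_apply hschema_meas]
  refine lintegral_congr_ae ?_
  filter_upwards [hhalt', ae_exists_false h1] with x hx hfalse
  by_cases hxA : x ∈ A
  · have heq := (P.bernoulliSequence_haltingEvent hx n c).trans
      (hP ▸ uniformProduct_schemaReturns C hfalse n c).symm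
    simpa [hxA] using heq
  · simp [hxA]

theorem sortedSuccess_trial_eq_egfCoeff : sortedSuccess.trial = egfCoeff sortedClass := by
  rw [egfCoeff_sortedClass]
  exact funext sortedSuccess_trial

theorem firstLargestSuccess_trial_eq_egfCoeff :
    firstLargestSuccess.trial = egfCoeff firstLargestClass := by
  rw [egfCoeff_firstLargestClass]
  exact funext firstLargestSuccess_trial

theorem sortedMachine_stronglySimulates : StronglySimulates sortedMachine poissonLaw := by
  refine sortedMachine_realizes.stronglySimulates
    (fun lam h0 h1 => sortedRule.hasExponentialTail h0 h1 _) fun lam h0 h1 n => ?_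
  rw [sortedSuccess.measureReal_haltingEvent_fst h0 h1 (Real.exp_pos lam)
    (sortedSuccess_trial_eq_egfCoeff ▸ hasSum_sortedClass lam), sortedSuccess_trial, poissonLaw,
    Real.exp_neg]
  ring

theorem firstLargestMachine_stronglySimulates :
    StronglySimulates firstLargestMachine logarithmicLaw := by
  refine firstLargestMachine_realizes.stronglySimulates
    (fun lam h0 h1 => firstLargestRule.hasExponentialTail h0 h1 _) fun lam h0 h1 n => ?_
  have h0' : (0 : ℝ) < lam := h0
  have h1' : (lam : ℝ) < 1 := h1
  have hlog : 0 < Real.log (1 - lam : ℝ)⁻¹ :=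
    Real.log_pos ((one_lt_inv₀ (sub_pos.2 h1')).2 (sub_lt_self 1 h0'))
  have hsum := hasSum_firstLargestClass (abs_lt.2 ⟨by linarith, h1'⟩)
  rw [firstLargestSuccess.measureReal_haltingEvent_fst h0 h1 hlog
    (firstLargestSuccess_trial_eq_egfCoeff ▸ hsum), firstLargestSuccess_trial, logarithmicLaw]
  split_ifs with hn
  · simp [hn]
  · ring

end Buffon

theorem theorem3 :
    (StronglySimulates sortedMachine poissonLaw ∧
      ImplementsSchema sortedMachine sortedClass ∧
      (stringRegisters sortedMachine).card = 1 ∧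
      ∀ z : ℝ, HasSum (fun n => egfCoeff sortedClass n * z ^ n) (Real.exp z)) ∧
    (StronglySimulates firstLargestMachine logarithmicLaw ∧
      ImplementsSchema firstLargestMachine firstLargestClass ∧
      (stringRegisters firstLargestMachine).card = 1 ∧
      ∀ z : ℝ, |z| < 1 →
        HasSum (fun n => egfCoeff firstLargestClass n * z ^ n) (Real.log (1 - z)⁻¹)) := by
  refine ⟨⟨sortedMachine_stronglySimulates, ?_, by decide, hasSum_sortedClass⟩,
    firstLargestMachine_stronglySimulates, ?_, by decide, fun z => hasSum_firstLargestClass⟩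
  · exact sortedMachine_realizes.implementsSchema sortedSuccess sortedSuccess_trial_eq_egfCoeff
  · exact firstLargestMachine_realizes.implementsSchema firstLargestSuccess
      firstLargestSuccess_trial_eq_egfCoeff
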